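/- For an undirected graph $G$ and an integer $l \ge 1$, an $l$-path in $G$ is a path with exactly $l$ vertices. A set $S \subseteq V(G)$ is an $l$-path vertex cover of $G$ if $G - S$ contains no $l$-path. In the $l$-path vertex cover problem the input is a finite undirected graph $G$ and an integer $k \ge 0$, and one has to decide whether $G$ has an $l$-path vertex cover of size at most $k$. There are deterministic algorithms that decide the $l$-path vertex cover problem in time $O^*(3.945^k)$ for $l = 5$, in time $O^*(4.947^k)$ for $l = 6$, and in time $O^*(5.951^k)$ for $l = 7$. Here time $O^*(c^k)$ means that there are constants $C$ and $d$ such that, for every graph $G$ with $n$ vertices and every $k$, the algorithm halts on $(G,k)$ with the correct answer after at most $C\,(n+1)^d\,c^k$ steps. An algorithm is a program in a first-order functional language with recursion on binary trees (first-order Lisp with the single atom nil), in which every evaluation step (variable access, $\mathrm{nil}$, $\mathrm{cons}$, $\mathrm{hd}$, $\mathrm{tl}$, test for $\mathrm{nil}$, local definition, function call) costs one unit of time. The graph is given by its adjacency matrix and $k$ is given in unary. -/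

import Mathlib

/-! ### The `l`-path vertex cover problem -/

namespace PathCover

/-- `G` contains an `l`-path, that is, a path with exactly `l` vertices. -/
def HasPath {V : Type*} (l : ℕ) (G : SimpleGraph V) : Prop :=
  ∃ (u v : V) (p : G.Walk u v), p.IsPath ∧ p.support.length = l

/-- `S` is an `l`-path vertex cover of `G`: the graph `G - S` (the subgraph of `G` induced by the
complement of `S`) contains no `l`-path. -/
def IsPathVertexCover {V : Type*} (l : ℕ) (G : SimpleGraph V) (S : Finset V) : Prop :=
  ¬ HasPath l (G.induce {v | v ∉ S})

/-- `(G, k)` is a yes-instance of the `l`-path vertex cover problem. -/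
def IsYesInstance {V : Type*} (l : ℕ) (G : SimpleGraph V) (k : ℕ) : Prop :=
  ∃ S : Finset V, S.card ≤ k ∧ IsPathVertexCover l G S

end PathCover

/-! ### The model of computation

Programs are finite systems of mutually recursive first-order functions on binary trees
(pure first-order Lisp, with `nil` as the only atom), evaluated call-by-value. Every evaluation
step costs one unit of time. The only operations on data are `nil`, `cons`, `hd`, `tl` and the test
for `nil`, so for a fixed program each step is a constant number of operations of a pointer machine:
trees are passed by reference, and they are never compared or copied in a single step. -/

namespace TreeLang

/-- The data: binary trees. -/
inductive Data : Type
  | nil : Data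
  | cons : Data → Data → Data

/-- The left component of a pair; `hd nil = nil` by convention. -/
def Data.hd : Data → Data
  | .nil => .nil
  | .cons a _ => a

/-- The right component of a pair; `tl nil = nil` by convention. -/
def Data.tl : Data → Data
  | .nil => .nil
  | .cons _ b => b

/-- Expressions, with variables as de Bruijn indices. -/
inductive Exp : Type
  /-- the `i`-th variable of the current environment -/
  | var (i : ℕ) : Exp
  | nil : Exp
  | cons (a b : Exp) : Exp
  | hd (e : Exp) : Exp
  | tl (e : Exp) : Exp
  /-- `if c is not nil then a else b` -/
  | ite (c a b : Exp) : Exp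
  /-- `let x := e in b`, where `x` is variable `0` of `b` -/
  | bind (e b : Exp) : Exp
  /-- call function number `f` of the program with argument `e` -/
  | call (f : ℕ) (e : Exp) : Exp

/-- A program is the finite list of the bodies of its functions. In a body, variable `0` is the
argument of the function. -/
abbrev Program : Type := List Exp

/-- `Eval P env e v t`: in the program `P`, the expression `e` evaluates in the environment `env`
to the value `v`, and the evaluation takes exactly `t` steps. In particular the evaluation
terminates. -/
inductive Eval (P : Program) : List Data → Exp → Data → ℕ → Prop
  | var {env : List Data} {i : ℕ} {v : Data} :
      env[i]? = some v → Eval P env (.var i) v 1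
  | nil {env : List Data} : Eval P env .nil .nil 1
  | cons {env : List Data} {a b : Exp} {u v : Data} {s t : ℕ} :
      Eval P env a u s → Eval P env b v t → Eval P env (.cons a b) (.cons u v) (s + t + 1)
  | hd {env : List Data} {e : Exp} {v : Data} {t : ℕ} :
      Eval P env e v t → Eval P env (.hd e) v.hd (t + 1)
  | tl {env : List Data} {e : Exp} {v : Data} {t : ℕ} :
      Eval P env e v t → Eval P env (.tl e) v.tl (t + 1)
  | iteTrue {env : List Data} {c a b : Exp} {x y v : Data} {s t : ℕ} :
      Eval P env c (.cons x y) s → Eval P env a v t → Eval P env (.ite c a b) v (s + t + 1)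
  | iteFalse {env : List Data} {c a b : Exp} {v : Data} {s t : ℕ} :
      Eval P env c .nil s → Eval P env b v t → Eval P env (.ite c a b) v (s + t + 1)
  | bind {env : List Data} {e b : Exp} {u v : Data} {s t : ℕ} :
      Eval P env e u s → Eval P (u :: env) b v t → Eval P env (.bind e b) v (s + t + 1)
  | call {env : List Data} {f : ℕ} {e body : Exp} {u v : Data} {s t : ℕ} :
      Eval P env e u s → P[f]? = some body → Eval P [u] body v t →
        Eval P env (.call f e) v (s + t + 1)

/-- Evaluation is deterministic: both the value and the number of steps are determined by the
program, the environment and the expression. -/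
theorem Eval.deterministic {P : Program} {env : List Data} {e : Exp} {v w : Data} {s t : ℕ}
    (h : Eval P env e v s) (h' : Eval P env e w t) : v = w ∧ s = t := by
  induction h generalizing w t with
  | var hi => cases h' with | var hj => exact ⟨Option.some.inj (hi.symm.trans hj), rfl⟩
  | nil => cases h'; exact ⟨rfl, rfl⟩
  | cons _ _ iha ihb =>
    cases h' with
    | cons ha hb =>
      obtain ⟨rfl, rfl⟩ := iha ha
      obtain ⟨rfl, rfl⟩ := ihb hb
      exact ⟨rfl, rfl⟩
  | hd _ ih => cases h' with | hd h => obtain ⟨rfl, rfl⟩ := ih h; exact ⟨rfl, rfl⟩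
  | tl _ ih => cases h' with | tl h => obtain ⟨rfl, rfl⟩ := ih h; exact ⟨rfl, rfl⟩
  | iteTrue _ _ ihc iha =>
    cases h' with
    | iteTrue hc ha =>
      obtain ⟨-, rfl⟩ := ihc hc
      obtain ⟨rfl, rfl⟩ := iha ha
      exact ⟨rfl, rfl⟩
    | iteFalse hc _ => exact absurd (ihc hc).1 (by simp)
  | iteFalse _ _ ihc ihb =>
    cases h' with
    | iteTrue hc _ => exact absurd (ihc hc).1 (by simp)
    | iteFalse hc hb =>
      obtain ⟨-, rfl⟩ := ihc hc
      obtain ⟨rfl, rfl⟩ := ihb hb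
      exact ⟨rfl, rfl⟩
  | bind _ _ ihe ihb =>
    cases h' with
    | bind he hb =>
      obtain ⟨rfl, rfl⟩ := ihe he
      obtain ⟨rfl, rfl⟩ := ihb hb
      exact ⟨rfl, rfl⟩
  | call _ hf _ ihe ihb =>
    cases h' with
    | call he hf' hb =>
      obtain ⟨rfl, rfl⟩ := ihe he
      obtain rfl := Option.some.inj (hf.symm.trans hf')
      obtain ⟨rfl, rfl⟩ := ihb hb
      exact ⟨rfl, rfl⟩

/-- Running a program: its function number `0` is called with the input as argument. -/
def Runs (P : Program) (input output : Data) (t : ℕ) : Prop :=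
  Eval P [input] (.call 0 (.var 0)) output t

/-! ### Encodings -/

/-- Lists as nested pairs. -/
def Data.ofList : List Data → Data
  | [] => .nil
  | a :: as => .cons a (Data.ofList as)

/-- `false` is `nil`, and `true` is `cons nil nil`. -/
def Data.ofBool : Bool → Data
  | false => .nil
  | true => .cons .nil .nil

/-- Natural numbers in unary. -/
def Data.ofNat (n : ℕ) : Data :=
  Data.ofList (List.replicate n .nil)

open Classical in
/-- Graphs on `n` vertices as adjacency matrices: the list of the `n` rows, each of which is
a list of `n` Booleans. -/
noncomputable def Data.ofGraph {n : ℕ} (G : SimpleGraph (Fin n)) : Data :=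
  Data.ofList (List.ofFn fun i : Fin n =>
    Data.ofList (List.ofFn fun j : Fin n => Data.ofBool (decide (G.Adj i j))))

open Classical in
/-- The program `P` decides the parameterized graph problem `Q` in time `O*(c ^ k)`: there are
constants `C` and `d` such that on every graph `G` with `n` vertices and every parameter `k` it
halts after at most `C * (n + 1) ^ d * c ^ k` steps, with output `true` if `(G, k)` is
a yes-instance of `Q` and output `false` otherwise. -/
def DecidesInTimeOStar (P : Program) (Q : ∀ n : ℕ, SimpleGraph (Fin n) → ℕ → Prop) (c : ℝ) : Prop :=
  ∃ C d : ℕ, ∀ (n : ℕ) (G : SimpleGraph (Fin n)) (k : ℕ), ∃ t : ℕ,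
    Runs P (.cons (Data.ofGraph G) (Data.ofNat k)) (Data.ofBool (decide (Q n G k))) t ∧
      (t : ℝ) ≤ C * ((n : ℝ) + 1) ^ d * c ^ k

end TreeLang

/-!
For every `l ≥ 1` and every `c > √(l * (l + 1) / 2)`, the `l`-path vertex cover problem can be
decided in time `O*(c ^ k)` (`TreeLang.exists_decidesInTimeOStar`); for `l = 5, 6, 7` these square
roots are less than `3.873`, `4.583` and `5.292`. The algorithm is a search tree with three rules.

* *A path `g 0, g 1, …` on `2 * l` vertices.* Let `g x` be the last vertex of a cover among the
  first `l` vertices. The `l` vertices after `g x` form an `l`-path too, so the cover contains some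
  `g y` with `l ≤ y ≤ x + l`. There are `l * (l + 1) / 2` such pairs, and each branch deletes two
  vertices (`PathCover.hasCover_iff_of_long_path`).
* *A small connected component.* It is deleted at the cost of its least cover
  (`PathCover.Twins.hasCover_iff_of_boundary_eq_empty`).
* *Twins:* many disjoint copies of a small graph whose vertices have no neighbours outside the copy
  and a common boundary `B`, and which are attached to `B` in the same way. One copy is deleted at
  the cost of its least cover (`PathCover.Twins.hasCover_iff`). Indeed, a least cover of the rest
  spends more than necessary on at most `|B|` copies, as it could contain `B` instead; so it treats
  some `l` copies in one and the same cheapest way. If the deleted copy is treated in this way as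
  well, an `l`-path through it could be rerouted through one of these `l` copies.

One of the rules always applies (`PathCover.exists_admissible`). If paths have bounded length, then
a connected set that is attached to the end of a path `B`, and that has no other neighbours than
those in `B`, has bounded size unless there are twins: after the deletion of a vertex `c` of the
set, its components are attached to the longer path formed by `B` and `c`, so by induction they are
small, and in the absence of twins each of the boundedly many isomorphism types over the boundary
occurs a bounded number of times (`PathCover.exists_card_bound`).

Whether a rule applies to a tuple of vertices is determined by the pattern of the tuple: its
equalities, its adjacencies, and which entries have all their neighbours in the tuple. For fixed `l`
the tuples have a fixed length, so a finite table of patterns and rules can be part of the program,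
which goes through all tuples. That this takes polynomial time follows from closure properties of
the class `TreeLang.PolyTime` of functions computed by relocatable code, and the size of the search
tree is estimated in `TreeLang.exists_search` by a weight function.
-/

namespace PathCover

/-! ### Paths as lists of vertices -/

section Covers

variable {V : Type*} {l k : ℕ} {G : SimpleGraph V}

/-- The list `p` is the vertex sequence of a path of `G` all of whose vertices lie in `D`. -/
structure IsPathOn (G : SimpleGraph V) (D : Set V) (p : List V) : Prop where
  chain : p.IsChain G.Adj
  nodup : p.Nodup
  mem : ∀ v ∈ p, v ∈ D

theorem IsPathOn.mono {D D' : Set V} {p : List V} (h : IsPathOn G D p) (hD : ∀ v ∈ p, v ∈ D') :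
    IsPathOn G D' p :=
  ⟨h.chain, h.nodup, hD⟩

theorem IsPathOn.map {W : Type*} {G' : SimpleGraph W} {D : Set V} {D' : Set W} {p : List V}
    (h : IsPathOn G D p) (φ : V → W) (hinj : Set.InjOn φ D) (hmaps : ∀ v ∈ D, φ v ∈ D')
    (hadj : ∀ u ∈ D, ∀ v ∈ D, G.Adj u v → G'.Adj (φ u) (φ v)) :
    IsPathOn G' D' (p.map φ) := by
  refine ⟨?_, ?_, ?_⟩
  · rw [List.isChain_map]
    exact List.IsChain.imp_of_mem_imp
      (fun u v hu hv huv => hadj u (h.mem u hu) v (h.mem v hv) huv) h.chain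
  · exact List.Nodup.map_on (fun u hu v hv e => hinj (h.mem u hu) (h.mem v hv) e) h.nodup
  · intro w hw
    obtain ⟨v, hv, rfl⟩ := List.mem_map.1 hw
    exact hmaps v (h.mem v hv)

theorem isPathOn_map_range {D : Set V} {g : ℕ → V} {N : ℕ}
    (hadj : ∀ i, i + 1 < N → G.Adj (g i) (g (i + 1))) (hinj : Set.InjOn g {i | i < N})
    (a l : ℕ) (hal : a + l ≤ N) (hD : ∀ i < l, g (a + i) ∈ D) :
    IsPathOn G D ((List.range l).map fun i => g (a + i)) := by
  refine ⟨?_, ?_, ?_⟩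
  · rw [List.isChain_iff_getElem]
    intro i hi
    simp only [List.length_map, List.length_range] at hi
    simpa [add_assoc] using hadj (a + i) (by omega)
  · refine List.Nodup.map_on (fun x hx y hy e => ?_) List.nodup_range
    simp only [List.mem_range] at hx hy
    have := hinj (show a + x < N by omega) (show a + y < N by omega) e
    omega
  · intro v hv
    obtain ⟨i, hi, rfl⟩ := List.mem_map.1 hv
    exact hD i (List.mem_range.1 hi)

/-- `S` meets every path on `l` vertices of the subgraph of `G` induced by `A`. -/
def Covers (l : ℕ) (G : SimpleGraph V) (A S : Finset V) : Prop :=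
  ∀ p : List V, IsPathOn G ((A : Set V) \ S) p → p.length ≠ l

/-- The subgraph of `G` induced by `A` has an `l`-path vertex cover of size at most `k`. -/
def HasCover (l : ℕ) (G : SimpleGraph V) (A : Finset V) (k : ℕ) : Prop :=
  ∃ S : Finset V, S.card ≤ k ∧ Covers l G A S

theorem hasPath_induce_iff (hl : 1 ≤ l) (D : Set V) :
    HasPath l (G.induce D) ↔ ∃ p, IsPathOn G D p ∧ p.length = l := by
  constructor
  · rintro ⟨u, v, p, hp, hlen⟩
    refine ⟨p.support.map Subtype.val, ⟨?_, ?_, ?_⟩, by simpa using hlen⟩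
    · rw [List.isChain_map]
      exact p.isChain_adj_support
    · exact hp.support_nodup.map Subtype.val_injective
    · intro w hw
      obtain ⟨x, -, rfl⟩ := List.mem_map.1 hw
      exact x.2
  · rintro ⟨p, hp, hlen⟩
    obtain ⟨q, rfl⟩ : p ∈ Set.range (List.map (Subtype.val : D → V)) := by
      rw [Set.range_list_map]
      intro v hv
      exact ⟨⟨v, hp.mem v hv⟩, rfl⟩
    have hne : q ≠ [] := by
      rintro rfl
      simp at hlen
      omega
    have hch : q.IsChain (G.induce D).Adj := by
      have := hp.chain
      rw [List.isChain_map] at this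
      exact this
    refine ⟨_, _, SimpleGraph.Walk.ofSupport q hne hch, ?_, ?_⟩
    · rw [SimpleGraph.Walk.isPath_def, SimpleGraph.Walk.support_ofSupport]
      exact hp.nodup.of_map _
    · rw [SimpleGraph.Walk.support_ofSupport]
      simpa using hlen

theorem isYesInstance_iff_hasCover [Fintype V] (hl : 1 ≤ l) :
    IsYesInstance l G k ↔ HasCover l G Finset.univ k := by
  unfold IsYesInstance HasCover IsPathVertexCover Covers
  refine exists_congr fun S => and_congr_right fun _ => ?_
  rw [hasPath_induce_iff hl]
  have : ((Finset.univ : Finset V) : Set V) \ S = {v | v ∉ S} := by ext; simp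
  rw [this]
  push Not
  rfl

variable [DecidableEq V]

theorem Covers.sdiff {A S : Finset V} (h : Covers l G A S) (X : Finset V) :
    Covers l G (A \ X) (S \ X) := by
  intro p hp
  refine h p (hp.mono fun v hv => ?_)
  have := hp.mem v hv
  simp only [Finset.coe_sdiff, Set.mem_sdiff, Finset.mem_coe] at this ⊢
  tauto

theorem Covers.union {A X S : Finset V} (h : Covers l G (A \ X) S) : Covers l G A (S ∪ X) := by
  intro p hp
  refine h p (hp.mono fun v hv => ?_)
  have := hp.mem v hv
  simp only [Finset.coe_sdiff, Finset.coe_union, Set.mem_sdiff, Set.mem_union,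
    Finset.mem_coe] at this ⊢
  tauto

/-! ### Branching on a path with `2 * l` vertices -/

/-- The pairs `(x, y)` of positions on a path with `2 * l` vertices such that `x` is among the
first `l` positions, `y` is not, and the distance from `x` to `y` is at most `l`. -/
def branchPairs (l : ℕ) : List (ℕ × ℕ) :=
  (List.range l).flatMap fun x => (List.range (x + 1)).map fun d => (x, l + d)

theorem mem_branchPairs {l : ℕ} {e : ℕ × ℕ} :
    e ∈ branchPairs l ↔ e.1 < l ∧ l ≤ e.2 ∧ e.2 ≤ e.1 + l := by
  obtain ⟨x, y⟩ := e
  simp only [branchPairs, List.mem_flatMap, List.mem_range, List.mem_map, Prod.mk.injEq]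
  constructor
  · rintro ⟨x', hx, d, hd, rfl, rfl⟩
    omega
  · rintro ⟨h1, h2, h3⟩
    exact ⟨x, h1, y - l, by omega, rfl, by omega⟩

theorem length_branchPairs (l : ℕ) : (branchPairs l).length * 2 = l * (l + 1) := by
  induction l with
  | zero => rfl
  | succ l ih =>
    have h : ∀ l, (branchPairs l).length = ((List.range l).map (· + 1)).sum := by
      intro l
      simp [branchPairs, List.length_flatMap]
    rw [h] at ih ⊢
    rw [List.range_succ, List.map_append, List.sum_append, add_mul, ih]
    simp
    ring

/-- A cover contains the last vertex `x` in it among the first `l` vertices of the path, and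
a vertex `y` among the `l` vertices that follow `x`; by the choice of `x`, the vertex `y` is not
among the first `l`. -/
theorem hasCover_iff_of_long_path {A : Finset V} {g : ℕ → V}
    (hadj : ∀ i, i + 1 < 2 * l → G.Adj (g i) (g (i + 1))) (hinj : Set.InjOn g {i | i < 2 * l})
    (hA : ∀ i < 2 * l, g i ∈ A) :
    HasCover l G A k ↔
      ∃ e ∈ branchPairs l, 2 ≤ k ∧ HasCover l G (A \ {g e.1, g e.2}) (k - 2) := by
  constructor
  · rintro ⟨S, hSk, hS⟩
    have key : ∀ a, a ≤ l → ∃ i < l, g (a + i) ∈ S := by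
      intro a ha
      by_contra! hcon
      refine hS _ (isPathOn_map_range hadj hinj a l (by omega) fun i hi => ?_) (by simp)
      exact ⟨hA _ (by omega), hcon i hi⟩
    obtain ⟨i₀, hi₀, hgi₀⟩ := key 0 (Nat.zero_le l)
    rw [zero_add] at hgi₀
    let P : ℕ → Prop := fun i => i < l ∧ g i ∈ S
    classical
    have hP : ∃ x, P x ∧ ∀ y, P y → y ≤ x := by
      refine ⟨Nat.findGreatest P l, Nat.findGreatest_spec (P := P) hi₀.le ⟨hi₀, hgi₀⟩, ?_⟩
      exact fun y hy => Nat.le_findGreatest hy.1.le hy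
    obtain ⟨x, ⟨hxl, hxS⟩, hmax⟩ := hP
    obtain ⟨d, hd, hyS⟩ := key (x + 1) hxl
    have hly : l ≤ x + 1 + d := by
      by_contra! hlt
      have := hmax _ ⟨hlt, hyS⟩
      omega
    have hne : g x ≠ g (x + 1 + d) := by
      intro e
      have := hinj (show x < 2 * l by omega) (show x + 1 + d < 2 * l by omega) e
      omega
    have hsub : {g x, g (x + 1 + d)} ⊆ S := by
      intro v hv
      simp only [Finset.mem_insert, Finset.mem_singleton] at hv
      rcases hv with rfl | rfl <;> assumption
    have hcard := Finset.card_sdiff_add_card_eq_card hsub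
    rw [Finset.card_pair hne] at hcard
    exact ⟨(x, x + 1 + d), mem_branchPairs.2 ⟨hxl, hly, by simp only; omega⟩, by omega,
      S \ {g x, g (x + 1 + d)}, by omega, hS.sdiff _⟩
  · rintro ⟨e, -, hk, S, hSk, hS⟩
    refine ⟨_, ?_, hS.union⟩
    have := Finset.card_union_le S {g e.1, g e.2}
    have := Finset.card_le_two (a := g e.1) (b := g e.2)
    omega

end Covers

/-! ### Reduction of repeated pieces -/

section Twins

variable {V ι : Type*} {l k s : ℕ} {G : SimpleGraph V}

/-- The least size of an `l`-path vertex cover of `H`. -/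
noncomputable def coverNumber (l : ℕ) (H : SimpleGraph (Fin s)) : ℕ :=
  sInf {k | HasCover l H Finset.univ k}

theorem hasCover_coverNumber (hl : 1 ≤ l) (H : SimpleGraph (Fin s)) :
    HasCover l H Finset.univ (coverNumber l H) := by
  refine Nat.sInf_mem (s := {k | HasCover l H Finset.univ k}) ⟨s, Finset.univ, by simp, ?_⟩
  rintro p hp rfl
  obtain ⟨v, hv⟩ := List.exists_mem_of_length_pos hl
  exact (hp.mem v hv).2 (by simp)

/-- Disjoint copies `t i` of the graph `H` in the subgraph of `G` induced by `A`. Their vertices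
have no neighbours outside the copy and the common boundary `B`, and corresponding vertices of the
copies have the same neighbours in `B`. -/
structure Twins (G : SimpleGraph V) (A B : Finset V) (H : SimpleGraph (Fin s))
    (t : ι → Fin s → V) : Prop where
  inj : ∀ {i a j b}, t i a = t j b → i = j ∧ a = b
  mem : ∀ i a, t i a ∈ A
  notMem : ∀ i a, t i a ∉ B
  adj : ∀ i a b, G.Adj (t i a) (t i b) ↔ H.Adj a b
  adj_boundary : ∀ i j a, ∀ v ∈ B, G.Adj (t i a) v ↔ G.Adj (t j a) v
  closed : ∀ i a, ∀ w ∈ A, G.Adj (t i a) w → w ∈ B ∨ ∃ b, t i b = w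

theorem forall_mem_of_isChain {R : V → V → Prop} {P : V → Prop} {p : List V} (h : p.IsChain R)
    (hR : ∀ u ∈ p, ∀ v ∈ p, R u v → (P u ↔ P v)) (hex : ∃ v ∈ p, P v) : ∀ v ∈ p, P v := by
  induction p with
  | nil => simp
  | cons a p ih =>
    cases p with
    | nil => simpa using hex
    | cons b p =>
      rw [List.isChain_cons_cons] at h
      have hab := hR a (by simp) b (by simp) h.1
      have ih' := ih h.2 (fun u hu v hv => hR u (List.mem_cons_of_mem _ hu) v
        (List.mem_cons_of_mem _ hv))
      have hb : ∀ v ∈ b :: p, P v := by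
        apply ih'
        obtain ⟨v, hv, hPv⟩ := hex
        rcases List.mem_cons.1 hv with rfl | hv
        · exact ⟨b, by simp, hab.1 hPv⟩
        · exact ⟨v, hv, hPv⟩
      intro v hv
      rcases List.mem_cons.1 hv with rfl | hv
      · exact hab.2 (hb b (by simp))
      · exact hb v hv

theorem Twins.injective {A B : Finset V} {H : SimpleGraph (Fin s)} {t : ι → Fin s → V}
    (h : Twins G A B H t) (i : ι) : Function.Injective (t i) :=
  fun _ _ e => (h.inj e).2

variable [DecidableEq V] {A B : Finset V} {H : SimpleGraph (Fin s)} {t : ι → Fin s → V}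

/-- The part of `S` in the copy `i`, as a set of vertices of the model graph. -/
def trace (t : ι → Fin s → V) (S : Finset V) (i : ι) : Finset (Fin s) :=
  Finset.univ.filter fun a => t i a ∈ S

theorem mem_trace {S : Finset V} {i : ι} {a : Fin s} : a ∈ trace t S i ↔ t i a ∈ S := by
  simp [trace]

namespace Twins

theorem coverNumber_le (h : Twins G A B H t) {A' S : Finset V} (hS : Covers l G A' S) {i : ι}
    (hi : ∀ a, t i a ∈ A') : coverNumber l H ≤ (trace t S i).card := by
  refine Nat.sInf_le ⟨trace t S i, le_rfl, fun p hp hlen => ?_⟩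
  refine hS (p.map (t i)) (hp.map (t i) (h.injective i).injOn ?_ ?_) (by simpa using hlen)
  · intro a ha
    refine ⟨hi a, fun haS => ha.2 ?_⟩
    exact mem_trace.2 haS
  · exact fun a _ b _ hab => (h.adj i a b).2 hab

/-- A path that avoids the boundary and meets a copy of `H` stays in that copy, where it is met by
a cover of `H`. -/
theorem notMem_of_isPathOn (h : Twins G A B H t) {D : Set V} {p : List V} (hp : IsPathOn G D p)
    (hlen : p.length = l) {i : ι} {X : Finset (Fin s)} (hX : Covers l H Finset.univ X)
    (hDA : ∀ v ∈ D, v ∈ A) (hDB : ∀ v ∈ D, v ∉ B) (hDX : ∀ a ∈ X, t i a ∉ D) :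
    ∀ v ∈ p, ∀ a, t i a ≠ v := by
  by_contra! hcon
  obtain ⟨v, hv, a, ha⟩ := hcon
  have hall : ∀ v ∈ p, ∃ a, t i a = v := by
    refine forall_mem_of_isChain hp.chain (fun u hu v hv huv => ?_) ⟨v, hv, a, ha⟩
    constructor
    · rintro ⟨a, rfl⟩
      exact (h.closed i a v (hDA _ (hp.mem v hv)) huv).resolve_left (hDB _ (hp.mem v hv))
    · rintro ⟨a, rfl⟩
      exact (h.closed i a u (hDA _ (hp.mem u hu)) huv.symm).resolve_left (hDB _ (hp.mem u hu))
  obtain ⟨q, rfl⟩ : p ∈ Set.range (List.map (t i)) := by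
    rw [Set.range_list_map]
    exact hall
  refine hX q ⟨?_, hp.nodup.of_map _, ?_⟩ (by simpa using hlen)
  · have := hp.chain
    rw [List.isChain_map] at this
    exact this.imp fun a b hab => (h.adj i a b).1 hab
  · intro a ha
    refine ⟨by simp, fun haX => hDX a haX (hp.mem _ (List.mem_map_of_mem ha))⟩

theorem hasCover_sdiff_of_hasCover (h : Twins G A B H t) (i : ι) (hc : HasCover l G A k) :
    coverNumber l H ≤ k ∧
      HasCover l G (A \ Finset.univ.image (t i)) (k - coverNumber l H) := by
  obtain ⟨S, hSk, hS⟩ := hc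
  have h1 := h.coverNumber_le hS (h.mem i)
  have h2 : S.card = (S \ Finset.univ.image (t i)).card + (trace t S i).card := by
    rw [← Finset.card_sdiff_add_card_inter S (Finset.univ.image (t i)),
      ← Finset.card_image_of_injective (trace t S i) (h.injective i)]
    congr 2
    ext v
    simp only [Finset.mem_inter, Finset.mem_image, mem_trace, Finset.mem_univ, true_and]
    constructor
    · rintro ⟨hv, a, rfl⟩
      exact ⟨a, hv, rfl⟩
    · rintro ⟨a, hv, rfl⟩
      exact ⟨hv, a, rfl⟩
  exact ⟨by omega, S \ Finset.univ.image (t i), by omega, hS.sdiff _⟩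

theorem hasCover_iff_of_boundary_eq_empty (h : Twins G A ∅ H t) (hl : 1 ≤ l) (i : ι) :
    HasCover l G A k ↔ coverNumber l H ≤ k ∧
      HasCover l G (A \ Finset.univ.image (t i)) (k - coverNumber l H) := by
  refine ⟨h.hasCover_sdiff_of_hasCover i, ?_⟩
  rintro ⟨hk, S, hSk, hS⟩
  obtain ⟨X, hXm, hX⟩ := hasCover_coverNumber hl H
  refine ⟨S ∪ X.image (t i), ?_, fun p hp hlen => ?_⟩
  · have := Finset.card_union_le S (X.image (t i))
    have := Finset.card_image_le (s := X) (f := t i)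
    omega
  · have hav := h.notMem_of_isPathOn hp hlen (i := i) hX (fun v hv => hv.1) (by simp)
      (fun a ha hD => hD.2 (by simpa using Or.inr ⟨a, ha, rfl⟩))
    refine hS p (hp.mono fun v hv => ?_) hlen
    have h1 := hp.mem v hv
    have h2 := hav v hv
    simp only [Finset.coe_union, Set.mem_sdiff, Set.mem_union, Finset.mem_coe] at h1
    simp only [Finset.coe_sdiff, Set.mem_sdiff, Finset.mem_coe, Finset.mem_image, Finset.mem_univ,
      true_and, not_exists]
    tauto

variable [Fintype ι] [DecidableEq ι]

/-- In a cover of least size after the deletion of the copy `i₀`, at most `|B|` copies contain more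
vertices than necessary: otherwise it is cheaper to take all of `B` and a least cover of each
copy. -/
theorem card_filter_le (h : Twins G A B H t) (hl : 1 ≤ l) (i₀ : ι) {S : Finset V}
    (hS : Covers l G (A \ Finset.univ.image (t i₀)) S)
    (hmin : ∀ S', Covers l G (A \ Finset.univ.image (t i₀)) S' → S.card ≤ S'.card) :
    ((Finset.univ.erase i₀).filter fun i => coverNumber l H < (trace t S i).card).card
      ≤ B.card := by
  obtain ⟨X, hXm, hX⟩ := hasCover_coverNumber hl H
  set I := Finset.univ.erase i₀ with hI
  set U := I.biUnion fun i => Finset.univ.image (t i) with hU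
  set Y := I.biUnion fun i => X.image (t i) with hY
  have hSU : S.card = (S \ U).card + ∑ i ∈ I, (trace t S i).card := by
    have : S ∩ U = I.biUnion fun i => (trace t S i).image (t i) := by
      ext v
      simp only [hU, Finset.mem_inter, Finset.mem_biUnion, Finset.mem_image, Finset.mem_univ,
        true_and, mem_trace]
      constructor
      · rintro ⟨hv, i, hi, a, rfl⟩
        exact ⟨i, hi, a, hv, rfl⟩
      · rintro ⟨i, hi, a, hv, rfl⟩
        exact ⟨hv, i, hi, a, rfl⟩
    rw [← Finset.card_sdiff_add_card_inter S U, this, Finset.card_biUnion]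
    · congr 1
      exact Finset.sum_congr rfl fun i _ => Finset.card_image_of_injective _ (h.injective i)
    · intro i _ j _ hij
      refine Finset.disjoint_left.2 fun v hv hv' => ?_
      obtain ⟨a, -, rfl⟩ := Finset.mem_image.1 hv
      obtain ⟨b, -, e⟩ := Finset.mem_image.1 hv'
      exact hij (h.inj e).1.symm
  have hYc : Y.card ≤ ∑ i ∈ I, coverNumber l H :=
    Finset.card_biUnion_le.trans
      (Finset.sum_le_sum fun i _ => Finset.card_image_le.trans hXm)
  have hcov : Covers l G (A \ Finset.univ.image (t i₀)) ((S \ U) ∪ (B ∪ Y)) := by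
    intro p hp hlen
    have hp' : ∀ v ∈ p, (v ∈ A ∧ v ∉ Finset.univ.image (t i₀)) ∧ (v ∈ S → v ∈ U) ∧ v ∉ B ∧ v ∉ Y := by
      intro v hv
      have := hp.mem v hv
      simp only [Finset.coe_sdiff, Finset.coe_union, Set.mem_sdiff, Set.mem_union,
        Finset.mem_coe] at this
      tauto
    have hav : ∀ i ∈ I, ∀ v ∈ p, ∀ a, t i a ≠ v := by
      intro i hi
      refine h.notMem_of_isPathOn (D := {v | v ∈ p})
        ⟨hp.chain, hp.nodup, fun v hv => hv⟩ hlen hX (fun v hv => (hp' v hv).1.1)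
        (fun v hv => (hp' v hv).2.2.1) (fun a ha hv => (hp' _ hv).2.2.2 ?_)
      exact Finset.mem_biUnion.2 ⟨i, hi, Finset.mem_image_of_mem _ ha⟩
    refine hS p (hp.mono fun v hv => ?_) hlen
    have h1 := hp' v hv
    refine ⟨by simpa only [Finset.mem_coe, Finset.mem_sdiff] using h1.1, fun hvS => ?_⟩
    obtain ⟨i, hi, hv'⟩ := Finset.mem_biUnion.1 (h1.2.1 hvS)
    obtain ⟨a, -, e⟩ := Finset.mem_image.1 hv'
    exact hav i hi v hv a e
  have hle := hmin _ hcov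
  have hu1 := Finset.card_union_le (S \ U) (B ∪ Y)
  have hu2 := Finset.card_union_le B Y
  have hsum : ∑ i ∈ I, coverNumber l H
      + (I.filter fun i => coverNumber l H < (trace t S i).card).card
      ≤ ∑ i ∈ I, (trace t S i).card := by
    rw [Finset.card_filter, ← Finset.sum_add_distrib]
    refine Finset.sum_le_sum fun i hi => ?_
    have h1 : coverNumber l H ≤ (trace t S i).card := by
      refine h.coverNumber_le hS fun a => ?_
      simp only [Finset.mem_sdiff, Finset.mem_image, Finset.mem_univ, true_and, not_exists]
      refine ⟨h.mem i a, fun b e => ?_⟩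
      exact (Finset.ne_of_mem_erase hi) (h.inj e).1.symm
    split_ifs <;> omega
  omega

/-- If there are many copies of `H` over the boundary `B`, one of them can be deleted at the price
of a least cover of `H`. A least cover of the rest treats some `l` of the remaining copies in the
same cheapest way; the deleted copy is treated in this way too, and a path on `l` vertices through
it can be rerouted through one of these `l` copies. -/
theorem hasCover_iff (h : Twins G A B H t) (hl : 1 ≤ l) (i₀ : ι)
    (hcard : B.card + 2 ^ s * l + 2 ≤ Fintype.card ι) :
    HasCover l G A k ↔ coverNumber l H ≤ k ∧
      HasCover l G (A \ Finset.univ.image (t i₀)) (k - coverNumber l H) := by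
  refine ⟨h.hasCover_sdiff_of_hasCover i₀, ?_⟩
  rintro ⟨hk, S₀, hS₀k, hS₀⟩
  obtain ⟨S, hS, hmin⟩ : ∃ S, Covers l G (A \ Finset.univ.image (t i₀)) S ∧
      ∀ S', Covers l G (A \ Finset.univ.image (t i₀)) S' → S.card ≤ S'.card := by
    obtain ⟨S, hS, hmin⟩ := WellFounded.has_min
      (InvImage.wf (Finset.card (α := V)) Nat.lt_wfRel.wf)
      {S | Covers l G (A \ Finset.univ.image (t i₀)) S} ⟨S₀, hS₀⟩
    exact ⟨S, hS, fun S' hS' => not_lt.1 (hmin S' hS')⟩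
  have hexp := h.card_filter_le hl i₀ hS hmin
  set I := Finset.univ.erase i₀ with hI
  have hIc : I.card + 1 = Fintype.card ι := by
    rw [hI, Finset.card_erase_add_one (Finset.mem_univ _), Finset.card_univ]
  have hsplit := Finset.card_filter_add_card_filter_not (s := I)
    fun i => coverNumber l H < (trace t S i).card
  obtain ⟨X, -, hX⟩ := Finset.exists_lt_card_fiber_of_mul_lt_card_of_maps_to
    (s := I.filter fun i => ¬ coverNumber l H < (trace t S i).card)
    (t := (Finset.univ : Finset (Finset (Fin s)))) (f := trace t S) (n := l)
    (fun _ _ => Finset.mem_univ _)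
    (by rw [Finset.card_univ, Fintype.card_finset, Fintype.card_fin]; omega)
  set F := (I.filter fun i => ¬ coverNumber l H < (trace t S i).card).filter
    fun i => trace t S i = X with hF
  have hFmem : ∀ i ∈ F, i ≠ i₀ ∧ (trace t S i).card ≤ coverNumber l H ∧ trace t S i = X := by
    intro i hi
    simp only [hF, hI, Finset.mem_filter, Finset.mem_erase, not_lt] at hi
    tauto
  have hXc : X.card ≤ coverNumber l H := by
    obtain ⟨i, hi⟩ := Finset.card_pos.1 (by omega : 0 < F.card)
    have := hFmem i hi
    rw [← this.2.2]
    exact this.2.1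
  refine ⟨S ∪ X.image (t i₀), ?_, fun p hp hlen => ?_⟩
  · have := Finset.card_union_le S (X.image (t i₀))
    have := Finset.card_image_le (s := X) (f := t i₀)
    have := hmin S₀ hS₀
    omega
  have hpm : ∀ v ∈ p, v ∈ A ∧ v ∉ S ∧ ∀ a ∈ X, t i₀ a ≠ v := by
    intro v hv
    have := hp.mem v hv
    simp only [Finset.coe_union, Set.mem_sdiff, Set.mem_union, Finset.mem_coe, not_or,
      Finset.mem_image, not_exists, not_and] at this
    exact this
  -- Since `p` has only `l` vertices, it misses one of the copies that `S` meets in `X`.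
  obtain ⟨j, hjF, hj⟩ : ∃ j ∈ F, ∀ a, t j a ∉ p := by
    by_contra! hcon
    obtain ⟨i, hi⟩ := Finset.card_pos.1 (by omega : 0 < F.card)
    have : Nonempty (Fin s) := ⟨(hcon i hi).choose⟩
    choose! a ha using hcon
    have : F.card ≤ p.toFinset.card :=
      Finset.card_le_card_of_injOn (fun i => t i (a i))
        (fun i hi => by simpa using ha i hi) (fun i _ j _ e => (h.inj e).1)
    have := List.toFinset_card_le p
    omega
  obtain ⟨hji, -, hjX⟩ := hFmem j hjF
  classical
  let φ : V → V := fun v => if hv : ∃ a, t i₀ a = v then t j hv.choose else v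
  have φ_eq : ∀ a, φ (t i₀ a) = t j a := by
    intro a
    have hex : ∃ b, t i₀ b = t i₀ a := ⟨a, rfl⟩
    have : φ (t i₀ a) = t j hex.choose := dif_pos hex
    rw [this, (h.inj hex.choose_spec).2]
  have φ_ne : ∀ v, (∀ a, t i₀ a ≠ v) → φ v = v := fun v hv => dif_neg (by push Not; exact hv)
  have φ_cases : ∀ v, (∃ a, v = t i₀ a) ∨ ∀ a, t i₀ a ≠ v := by
    intro v
    by_cases hv : ∃ a, t i₀ a = v
    · obtain ⟨a, rfl⟩ := hv
      exact Or.inl ⟨a, rfl⟩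
    · push Not at hv
      exact Or.inr hv
  refine hS (p.map φ) (IsPathOn.map (D := {v | v ∈ p}) ⟨hp.chain, hp.nodup, fun v hv => hv⟩ φ
    ?_ ?_ ?_) (by simpa using hlen)
  · intro u hu v hv e
    rcases φ_cases u with ⟨a, rfl⟩ | hu' <;> rcases φ_cases v with ⟨b, rfl⟩ | hv'
    · rw [φ_eq, φ_eq] at e
      rw [(h.inj e).2]
    · rw [φ_eq, φ_ne v hv'] at e
      exact absurd (e ▸ hv) (hj a)
    · rw [φ_eq, φ_ne u hu'] at e
      exact absurd (e ▸ hu) (hj b)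
    · rwa [φ_ne u hu', φ_ne v hv'] at e
  · intro v hv
    have hv1 := hpm v hv
    simp only [Finset.coe_sdiff, Set.mem_sdiff, Finset.mem_coe, Finset.mem_image, Finset.mem_univ,
      true_and, not_exists]
    rcases φ_cases v with ⟨a, rfl⟩ | hv'
    · rw [φ_eq]
      refine ⟨⟨h.mem j a, fun b e => hji (h.inj e).1.symm⟩, fun hS' => ?_⟩
      exact hv1.2.2 a (hjX ▸ mem_trace.2 hS') rfl
    · rw [φ_ne v hv']
      exact ⟨⟨hv1.1, hv'⟩, hv1.2.1⟩
  · intro u hu v hv huv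
    have hout : ∀ a, ∀ w ∈ p, (∀ b, t i₀ b ≠ w) → G.Adj (t i₀ a) w → G.Adj (t j a) w := by
      intro a w hw hw' haw
      have hwB := (h.closed i₀ a w (hpm w hw).1 haw).resolve_right (by push Not; exact hw')
      exact (h.adj_boundary i₀ j a w hwB).1 haw
    rcases φ_cases u with ⟨a, rfl⟩ | hu' <;> rcases φ_cases v with ⟨b, rfl⟩ | hv'
    · rw [φ_eq, φ_eq, h.adj, ← h.adj i₀]
      exact huv
    · rw [φ_eq, φ_ne v hv']
      exact hout a v hv hv' huv
    · rw [φ_eq, φ_ne u hu']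
      exact (hout b u hu hu' huv.symm).symm
    · rwa [φ_ne u hu', φ_ne v hv']

end Twins

end Twins

/-! ### Small pieces or repeated pieces in graphs without long paths -/

section Structure

variable {V : Type*} {G : SimpleGraph V}

/-- The graph on all of `V` whose edges are the edges of `G` inside `D`. -/
def restrict (G : SimpleGraph V) (D : Finset V) : SimpleGraph V where
  Adj u v := G.Adj u v ∧ u ∈ D ∧ v ∈ D
  symm := ⟨fun _ _ h => ⟨h.1.symm, h.2.2, h.2.1⟩⟩
  loopless := ⟨fun _ h => G.loopless.irrefl _ h.1⟩

open Classical in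
/-- The vertices of the connected component of `x` in the subgraph of `G` induced by `D`. -/
noncomputable def component (G : SimpleGraph V) (D : Finset V) (x : V) : Finset V :=
  D.filter fun v => (restrict G D).Reachable x v

theorem mem_component {D : Finset V} {x v : V} :
    v ∈ component G D x ↔ v ∈ D ∧ (restrict G D).Reachable x v := by
  simp [component]

theorem component_subset {D : Finset V} {x : V} : component G D x ⊆ D :=
  fun _ hv => (mem_component.1 hv).1

theorem self_mem_component {D : Finset V} {x : V} (hx : x ∈ D) : x ∈ component G D x :=
  mem_component.2 ⟨hx, SimpleGraph.Reachable.refl x⟩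

theorem mem_component_of_adj {D : Finset V} {x v w : V} (hv : v ∈ component G D x) (hw : w ∈ D)
    (hvw : G.Adj v w) : w ∈ component G D x := by
  rw [mem_component] at hv ⊢
  exact ⟨hw, hv.2.trans (SimpleGraph.Adj.reachable ⟨hvw, hv.1, hw⟩)⟩

theorem component_eq {D : Finset V} {x y : V} (hy : y ∈ component G D x) :
    component G D y = component G D x := by
  have h := (mem_component.1 hy).2
  ext v
  rw [mem_component, mem_component]
  exact and_congr_right fun _ => ⟨fun h' => h.trans h', fun h' => h.symm.trans h'⟩

theorem reachable_of_mem_component {D : Finset V} {x u v : V} (hx : x ∈ D)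
    (hu : u ∈ component G D x) (hv : v ∈ component G D x) :
    (restrict G (component G D x)).Reachable u v := by
  have key : ∀ v, (restrict G D).Reachable x v →
      (restrict G (component G D x)).Reachable x v ∧ v ∈ component G D x := by
    intro v hv
    rw [SimpleGraph.reachable_iff_reflTransGen] at hv
    induction hv with
    | refl => exact ⟨SimpleGraph.Reachable.refl x, self_mem_component hx⟩
    | tail _ hab ih =>
      have hb := mem_component_of_adj ih.2 hab.2.2 hab.1
      exact ⟨ih.1.trans (SimpleGraph.Adj.reachable ⟨hab.1, ih.2, hb⟩), hb⟩
  exact (key u (mem_component.1 hu).2).1.symm.trans (key v (mem_component.1 hv).2).1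

/-- Deleting a vertex `c` from a connected set leaves components that are adjacent to `c`. -/
theorem exists_adj_of_component_erase [DecidableEq V] {C : Finset V} {c x : V} (hx : x ∈ C.erase c)
    (hconn : (restrict G C).Reachable x c) : ∃ v ∈ component G (C.erase c) x, G.Adj v c := by
  have key : ∀ y, (restrict G C).Reachable x y →
      y ∈ component G (C.erase c) x ∨ ∃ v ∈ component G (C.erase c) x, G.Adj v c := by
    intro y hy
    rw [SimpleGraph.reachable_iff_reflTransGen] at hy
    induction hy with
    | refl => exact Or.inl (self_mem_component hx)
    | @tail a b _ hab ih =>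
      rcases ih with ih | ih
      · by_cases hb : b = c
        · subst hb
          exact Or.inr ⟨a, ih, hab.1⟩
        · exact Or.inl (mem_component_of_adj ih (Finset.mem_erase.2 ⟨hb, hab.2.2⟩) hab.1)
      · exact Or.inr ih
  refine (key c hconn).resolve_left fun h => ?_
  exact Finset.notMem_erase c C (component_subset h)

/-- Every finite set is enumerated by the natural numbers below its cardinality. -/
theorem exists_enumeration [Nonempty V] (X : Finset V) : ∃ e : ℕ → V, (∀ i < X.card, e i ∈ X) ∧
    (∀ i < X.card, ∀ j < X.card, e i = e j → i = j) ∧ ∀ v ∈ X, ∃ i < X.card, e i = v := by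
  classical
  obtain ⟨v₀⟩ := ‹Nonempty V›
  refine ⟨fun i => if h : i < X.card then (X.equivFin.symm ⟨i, h⟩ : V) else v₀, ?_, ?_, ?_⟩
  · intro i hi
    simp [hi]
  · intro i hi j hj e
    simpa [hi, hj] using e
  · intro v hv
    refine ⟨X.equivFin ⟨v, hv⟩, Fin.is_lt _, ?_⟩
    simp

/-- The subgraph of `G` induced by `A` contains enough disjoint copies of a nonempty graph over
a common boundary for one copy to be redundant, and they have at most `R` vertices together with
the boundary. -/
def HasTwins (l R : ℕ) (G : SimpleGraph V) (A : Finset V) : Prop :=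
  ∃ (B : Finset V) (q s : ℕ) (H : SimpleGraph (Fin s)) (t : Fin q → Fin s → V),
    Twins G A B H t ∧ B.card + 2 ^ s * l + 2 ≤ q ∧ 0 < s ∧ B.card + q * s ≤ R

theorem HasTwins.mono {l R R' : ℕ} {A : Finset V} (h : HasTwins l R G A) (hR : R ≤ R') :
    HasTwins l R' G A := by
  obtain ⟨B, q, s, H, t, h1, h2, h3, h4⟩ := h
  exact ⟨B, q, s, H, t, h1, h2, h3, h4.trans hR⟩

/-- The isomorphism type of a graph with at most `t` vertices over an ordered boundary with at most
`M` vertices: its number of vertices, its adjacency relation and the adjacency to the boundary. -/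
abbrev PieceType (t M : ℕ) : Type :=
  Fin (t + 1) × (Fin t → Fin t → Prop) × (Fin t → Fin M → Prop)

open Classical in
/-- Among sufficiently many small sets that are separated by the boundary `B`, there are twins. -/
theorem hasTwins_of_many {l t M q : ℕ} (hq : M + 2 ^ t * l + 2 ≤ q) {A : Finset V} {B : List V}
    (hBM : B.length ≤ M) {𝒞 : Finset (Finset V)} (hA : ∀ X ∈ 𝒞, X ⊆ A)
    (hB : ∀ X ∈ 𝒞, ∀ v ∈ X, v ∉ B) (hne : ∀ X ∈ 𝒞, X.Nonempty) (hcard : ∀ X ∈ 𝒞, X.card ≤ t)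
    (hdisj : ∀ X ∈ 𝒞, ∀ Y ∈ 𝒞, ∀ v, v ∈ X → v ∈ Y → X = Y)
    (hclosed : ∀ X ∈ 𝒞, ∀ v ∈ X, ∀ w ∈ A, G.Adj v w → w ∈ B ∨ w ∈ X)
    (hmany : Fintype.card (PieceType t M) * q < 𝒞.card) : HasTwins l (M + q * t) G A := by
  obtain ⟨X₀, hX₀⟩ : 𝒞.Nonempty := Finset.card_pos.1 (by omega)
  have : Nonempty V := ⟨(hne X₀ hX₀).choose⟩
  choose e he_mem he_inj he_surj using exists_enumeration (V := V)
  let ty : Finset V → PieceType t M := fun X =>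
    (Fin.ofNat (t + 1) X.card, fun a b => G.Adj (e X a) (e X b),
      fun a i => ∃ v, B[(i : ℕ)]? = some v ∧ G.Adj (e X a) v)
  obtain ⟨y, -, hy⟩ := Finset.exists_lt_card_fiber_of_mul_lt_card_of_maps_to (s := 𝒞)
    (t := (Finset.univ : Finset (PieceType t M))) (f := ty) (n := q)
    (fun _ _ => Finset.mem_univ _) (by rw [Finset.card_univ]; exact hmany)
  set 𝒟 := 𝒞.filter fun X => ty X = y with h𝒟
  have hD : ∀ X ∈ 𝒟, X ∈ 𝒞 ∧ ty X = y := fun X hX => Finset.mem_filter.1 hX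
  let x : Fin q → Finset V := fun i => 𝒟.equivFin.symm ⟨i, i.2.trans hy⟩
  have hx : ∀ i, x i ∈ 𝒟 := fun i => (𝒟.equivFin.symm ⟨i, i.2.trans hy⟩).2
  have hxC : ∀ i, x i ∈ 𝒞 := fun i => (hD _ (hx i)).1
  have hxinj : ∀ i j, x i = x j → i = j := by
    intro i j h
    have := 𝒟.equivFin.symm.injective (Subtype.ext h)
    simpa [Fin.ext_iff] using this
  let i₀ : Fin q := ⟨0, by omega⟩
  have hty : ∀ i j, ty (x i) = ty (x j) := fun i j =>
    (hD _ (hx i)).2.trans (hD _ (hx j)).2.symm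
  have hs : ∀ i, (x i).card = (x i₀).card := by
    intro i
    have := congrArg (fun z : PieceType t M => (z.1 : ℕ)) (hty i i₀)
    simpa [ty, Fin.ofNat, Nat.mod_eq_of_lt, Nat.lt_succ_of_le, hcard _ (hxC i),
      hcard _ (hxC i₀)] using this
  set s := (x i₀).card with hsdef
  have hst : s ≤ t := hcard _ (hxC i₀)
  have hlt : ∀ (a : Fin s) i, (a : ℕ) < (x i).card := fun a i => by rw [hs]; exact a.2
  have hBc : B.toFinset.card ≤ M := (List.toFinset_card_le B).trans hBM
  have h2 : 2 ^ s * l ≤ 2 ^ t * l :=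
    Nat.mul_le_mul_right _ (Nat.pow_le_pow_right (by norm_num) hst)
  refine ⟨B.toFinset, q, s, G.comap fun a : Fin s => e (x i₀) a, fun i a => e (x i) a,
    ⟨?_, ?_, ?_, ?_, ?_, ?_⟩, by omega, Finset.card_pos.2 (hne _ (hxC i₀)),
    Nat.add_le_add hBc (Nat.mul_le_mul_left _ hst)⟩
  · intro i a j b hij
    have hX := hdisj _ (hxC i) _ (hxC j) (e (x i) a) (he_mem _ _ (hlt a i))
      (by rw [hij]; exact he_mem _ _ (hlt b j))
    obtain rfl := hxinj _ _ hX
    exact ⟨rfl, Fin.ext (he_inj _ _ (hlt a i) _ (hlt b i) hij)⟩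
  · exact fun i a => hA _ (hxC i) (he_mem _ _ (hlt a i))
  · intro i a
    rw [List.mem_toFinset]
    exact hB _ (hxC i) _ (he_mem _ _ (hlt a i))
  · intro i a b
    have := congrArg (fun z : PieceType t M => z.2.1 ⟨a, a.2.trans_le hst⟩ ⟨b, b.2.trans_le hst⟩)
      (hty i i₀)
    exact iff_of_eq this
  · have key : ∀ i j (a : Fin s), ∀ v ∈ B, G.Adj (e (x i) a) v → G.Adj (e (x j) a) v := by
      intro i j a v hv hadj
      obtain ⟨m, hm, rfl⟩ := List.mem_iff_getElem.1 hv
      have := congrArg (fun z : PieceType t M => z.2.2 ⟨a, a.2.trans_le hst⟩ ⟨m, hm.trans_le hBM⟩)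
        (hty i j)
      obtain ⟨v, hv, hadj'⟩ := (iff_of_eq this).1 ⟨_, List.getElem?_eq_getElem hm, hadj⟩
      rw [List.getElem?_eq_getElem hm] at hv
      obtain rfl := Option.some.inj hv
      exact hadj'
    intro i j a v hv
    rw [List.mem_toFinset] at hv
    exact ⟨key i j a v hv, key j i a v hv⟩
  · intro i a w hw hadj
    rw [List.mem_toFinset]
    refine (hclosed _ (hxC i) _ (he_mem _ _ (hlt a i)) w hw hadj).imp id fun hwX => ?_
    obtain ⟨m, hm, rfl⟩ := he_surj _ w hwX
    exact ⟨⟨m, by rwa [hs] at hm⟩, rfl⟩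

open Classical in
/-- Let `B` be a path in a graph whose paths have at most `M` vertices, and let `C` be a connected
set without neighbours outside `C` and `B`, such that `B` can be extended to a vertex `c` of `C`.
If there are no twins, then the size of `C` is bounded: by induction, the components of `C - c`
have bounded size, since `B` with `c` is a longer path, and there are boundedly many of them. -/
theorem exists_card_bound (l M d : ℕ) : ∃ t R : ℕ, ∀ {V : Type} (G : SimpleGraph V) (A : Finset V)
    (B : List V) (C : Finset V), (∀ p, IsPathOn G A p → p.length ≤ M) → M ≤ B.length + d →
    IsPathOn G A B → (∃ c ∈ C, (c :: B).IsChain G.Adj) → C ⊆ A → (∀ v ∈ C, v ∉ B) →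
    (∀ x ∈ C, ∀ y ∈ C, (restrict G C).Reachable x y) →
    (∀ v ∈ C, ∀ w ∈ A, G.Adj v w → w ∈ B ∨ w ∈ C) → C.card ≤ t ∨ HasTwins l R G A := by
  have hext : ∀ {V : Type} {G : SimpleGraph V} {A C : Finset V} {B : List V} {c : V},
      IsPathOn G A B → c ∈ C → (c :: B).IsChain G.Adj → C ⊆ A → (∀ v ∈ C, v ∉ B) →
      IsPathOn G A (c :: B) := by
    intro V G A C B c hB hc hch hCA hCB
    refine ⟨hch, List.nodup_cons.2 ⟨hCB c hc, hB.nodup⟩, fun v hv => ?_⟩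
    rcases List.mem_cons.1 hv with rfl | hv
    · exact hCA hc
    · exact hB.mem v hv
  induction d with
  | zero =>
    refine ⟨0, 0, fun {V} G A B C hM hd hB ⟨c, hc, hch⟩ hCA hCB _ _ => ?_⟩
    have := hM _ (hext hB hc hch hCA hCB)
    rw [List.length_cons] at this
    omega
  | succ d ih =>
    obtain ⟨t, R, ih⟩ := ih
    set q := M + 2 ^ t * l + 2 with hq
    refine ⟨1 + Fintype.card (PieceType t M) * q * t, max R (M + q * t),
      fun {V} G A B C hM hd hB ⟨c, hc, hch⟩ hCA hCB hconn hclosed => ?_⟩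
    by_cases htw : HasTwins l (max R (M + q * t)) G A
    · exact Or.inr htw
    left
    have hcB := hext hB hc hch hCA hCB
    set D := C.erase c with hD
    have hDC : D ⊆ C := Finset.erase_subset c C
    have hDB : ∀ v ∈ D, v ∉ c :: B := by
      intro v hv hvB
      rcases List.mem_cons.1 hvB with rfl | hvB
      · exact Finset.notMem_erase v C hv
      · exact hCB v (hDC hv) hvB
    have hDclosed : ∀ x, ∀ v ∈ component G D x, ∀ w ∈ A, G.Adj v w →
        w ∈ c :: B ∨ w ∈ component G D x := by
      intro x v hv w hw hvw
      rcases hclosed v (hDC (component_subset hv)) w hw hvw with hwB | hwC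
      · exact Or.inl (List.mem_cons_of_mem _ hwB)
      · by_cases hwc : w = c
        · subst hwc
          exact Or.inl (by simp)
        · exact Or.inr (mem_component_of_adj hv (Finset.mem_erase.2 ⟨hwc, hwC⟩) hvw)
    have hsmall : ∀ x ∈ D, (component G D x).card ≤ t := by
      intro x hx
      refine (ih G A (c :: B) (component G D x) hM (by rw [List.length_cons]; omega) hcB ?_
        (component_subset.trans (hDC.trans hCA)) (fun v hv => hDB v (component_subset hv))
        (fun u hu v hv => reachable_of_mem_component hx hu hv) (hDclosed x)).resolve_right
        fun h => htw (h.mono (le_max_left _ _))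
      obtain ⟨v, hv, hvc⟩ := exists_adj_of_component_erase hx (hconn x (hDC hx) c hc)
      exact ⟨v, hv, List.isChain_cons_cons.2 ⟨hvc, hch⟩⟩
    have hnum : (D.image (component G D)).card ≤ Fintype.card (PieceType t M) * q := by
      by_contra! hlt
      refine htw (HasTwins.mono (hasTwins_of_many (B := c :: B) (le_refl _) (hM _ hcB)
        ?_ ?_ ?_ ?_ ?_ ?_ hlt) (le_max_right _ _))
      all_goals
        intro X hX
        obtain ⟨x, hx, rfl⟩ := Finset.mem_image.1 hX
      · exact component_subset.trans (hDC.trans hCA)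
      · exact fun v hv => hDB v (component_subset hv)
      · exact ⟨x, self_mem_component hx⟩
      · exact hsmall x hx
      · intro Y hY v hv hv'
        obtain ⟨y, hy, rfl⟩ := Finset.mem_image.1 hY
        exact (component_eq hv).symm.trans (component_eq hv')
      · exact hDclosed x
    have hDcard : D.card ≤ Fintype.card (PieceType t M) * q * t := by
      have : D ⊆ (D.image (component G D)).biUnion id := fun v hv =>
        Finset.mem_biUnion.2 ⟨_, Finset.mem_image_of_mem _ hv, self_mem_component hv⟩
      refine (Finset.card_le_card this).trans ((Finset.card_biUnion_le_card_mul _ _ t ?_).trans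
        (Nat.mul_le_mul_right _ hnum))
      intro X hX
      obtain ⟨x, hx, rfl⟩ := Finset.mem_image.1 hX
      exact hsmall x hx
    have := Finset.card_erase_add_one hc
    rw [← hD] at this
    omega

/-- A nonempty graph whose paths have at most `M` vertices has a small connected component or
twins. -/
theorem exists_small_component_or_hasTwins (l M : ℕ) : ∃ t R : ℕ, ∀ {V : Type} (G : SimpleGraph V)
    (A : Finset V), A.Nonempty → (∀ p, IsPathOn G A p → p.length ≤ M) →
    (∃ C ⊆ A, C.Nonempty ∧ C.card ≤ t ∧ ∀ v ∈ C, ∀ w ∈ A, G.Adj v w → w ∈ C) ∨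
      HasTwins l R G A := by
  obtain ⟨t, R, h⟩ := exists_card_bound l M M
  refine ⟨t, R, fun {V} G A ⟨x, hx⟩ hM => ?_⟩
  have hclosed : ∀ v ∈ component G A x, ∀ w ∈ A, G.Adj v w → w ∈ component G A x :=
    fun v hv w hw hvw => mem_component_of_adj hv hw hvw
  refine (h G A [] (component G A x) hM (by simp) ⟨by simp, by simp, by simp⟩
    ⟨x, self_mem_component hx, by simp⟩ component_subset (by simp)
    (fun u hu v hv => reachable_of_mem_component hx hu hv)
    (fun v hv w hw hvw => Or.inr (hclosed v hv w hw hvw))).imp (fun hc => ?_) id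
  exact ⟨_, component_subset, ⟨x, self_mem_component hx⟩, hc, hclosed⟩

end Structure

/-! ### Branching rules that depend only on the pattern of a tuple of vertices -/

section Rules

variable {R l : ℕ}

/-- A pattern of an `R`-tuple of vertices: which entries are equal, which entries are adjacent, and
which entries have all their neighbours in the tuple. -/
abbrev Pattern (R : ℕ) : Type := (Fin R × Fin R) ⊕ (Fin R × Fin R) ⊕ Fin R → Prop

/-- The pattern of the tuple `f` in the subgraph of `G` induced by `A`. -/
def pattern {V : Type*} (G : SimpleGraph V) (A : Finset V) (f : Fin R → V) : Pattern R
  | .inl (i, j) => f i = f j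
  | .inr (.inl (i, j)) => G.Adj (f i) (f j)
  | .inr (.inr i) => ∀ w ∈ A, G.Adj (f i) w → ∃ j, f j = w

section Pattern

variable {V V' : Type*} {G : SimpleGraph V} {G' : SimpleGraph V'} {A : Finset V} {A' : Finset V'}
  {f : Fin R → V} {f' : Fin R → V'}

theorem eq_iff_of_pattern_eq (h : pattern G A f = pattern G' A' f') (i j : Fin R) :
    f i = f j ↔ f' i = f' j :=
  iff_of_eq (congrFun h (.inl (i, j)))

theorem adj_iff_of_pattern_eq (h : pattern G A f = pattern G' A' f') (i j : Fin R) :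
    G.Adj (f i) (f j) ↔ G'.Adj (f' i) (f' j) :=
  iff_of_eq (congrFun h (.inr (.inl (i, j))))

theorem closed_iff_of_pattern_eq (h : pattern G A f = pattern G' A' f') (i : Fin R) :
    (∀ w ∈ A, G.Adj (f i) w → ∃ j, f j = w) ↔ ∀ w ∈ A', G'.Adj (f' i) w → ∃ j, f' j = w :=
  iff_of_eq (congrFun h (.inr (.inr i)))

variable [DecidableEq V] [DecidableEq V']

theorem Twins.of_pattern_eq (hπ : pattern G A f = pattern G' A' f') (hA : ∀ i, f i ∈ A)
    (hA' : ∀ i, f' i ∈ A') {ι : Type*} {s : ℕ} {H : SimpleGraph (Fin s)} {b : Finset (Fin R)}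
    {τ : ι → Fin s → Fin R} (h : Twins G A (b.image f) H fun i a => f (τ i a)) :
    Twins G' A' (b.image f') H fun i a => f' (τ i a) := by
  have hb : ∀ j, f j ∈ b.image f ↔ f' j ∈ b.image f' := by
    intro j
    simp only [Finset.mem_image]
    exact exists_congr fun i => and_congr_right fun _ => eq_iff_of_pattern_eq hπ i j
  refine ⟨?_, fun i a => hA' _, ?_, ?_, ?_, ?_⟩
  · intro i a j c e
    exact h.inj ((eq_iff_of_pattern_eq hπ _ _).2 e)
  · exact fun i a hm => h.notMem i a ((hb _).2 hm)
  · exact fun i a c => (adj_iff_of_pattern_eq hπ _ _).symm.trans (h.adj i a c)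
  · intro i j a v hv
    obtain ⟨m, hm, rfl⟩ := Finset.mem_image.1 hv
    rw [← adj_iff_of_pattern_eq hπ, ← adj_iff_of_pattern_eq hπ]
    exact h.adj_boundary i j a _ (Finset.mem_image_of_mem f hm)
  · intro i a w hw hadj
    have hcl := (closed_iff_of_pattern_eq hπ (τ i a)).1 (fun v hv hadjv => by
      rcases h.closed i a v hv hadjv with hvB | ⟨c, hc⟩
      · obtain ⟨m, -, hm⟩ := Finset.mem_image.1 hvB
        exact ⟨m, hm⟩
      · exact ⟨_, hc⟩)
    obtain ⟨j, rfl⟩ := hcl w hw hadj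
    rcases h.closed i a (f j) (hA j) ((adj_iff_of_pattern_eq hπ _ _).2 hadj) with hj | ⟨c, hc⟩
    · exact Or.inl ((hb j).1 hj)
    · exact Or.inr ⟨c, (eq_iff_of_pattern_eq hπ _ _).1 hc⟩

end Pattern

/-- A branching rule: each branch deletes the entries of the tuple with the given positions and
lowers the budget by the given amount. -/
abbrev Rule (R : ℕ) : Type := List (Finset (Fin R) × ℕ)

/-- A rule is admissible for a pattern if it is correct for all tuples with this pattern, every
branch deletes at least one vertex, and the branching factor is at most `c`. -/
structure Rule.Admissible (l : ℕ) (c : ℝ) (π : Pattern R) (L : Rule R) : Prop where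
  hasCover_iff : ∀ (n : ℕ) (G : SimpleGraph (Fin n)) (A : Finset (Fin n)) (f : Fin R → Fin n),
    (∀ i, f i ∈ A) → pattern G A f = π → ∀ k, HasCover l G A k ↔
      ∃ b ∈ L, b.2 ≤ k ∧ HasCover l G (A \ b.1.image f) (k - b.2)
  nonempty : ∀ b ∈ L, b.1.Nonempty
  sum_le : (L.map fun b => c⁻¹ ^ b.2).sum ≤ 1

theorem inv_pow_le_one {c : ℝ} (hc : 1 ≤ c) (m : ℕ) : c⁻¹ ^ m ≤ 1 :=
  pow_le_one₀ (by positivity) (inv_le_one_of_one_le₀ hc)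

theorem exists_admissible_of_twins {c : ℝ} (hc : 1 ≤ c) (hl : 1 ≤ l) {V : Type*} [DecidableEq V]
    {G : SimpleGraph V} {A : Finset V} {f : Fin R → V} (hA : ∀ i, f i ∈ A) {q s : ℕ} (hs : 0 < s)
    {H : SimpleGraph (Fin s)} {b : Finset (Fin R)} {τ : Fin q → Fin s → Fin R}
    (h : Twins G A (b.image f) H fun i a => f (τ i a)) (i₀ : Fin q)
    (hq : b = ∅ ∨ b.card + 2 ^ s * l + 2 ≤ q) :
    ∃ L : Rule R, L.Admissible l c (pattern G A f) := by
  refine ⟨[(Finset.univ.image (τ i₀), coverNumber l H)], ?_, ?_, ?_⟩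
  · intro n G' A' f' hA' hπ k
    have h' := Twins.of_pattern_eq hπ.symm hA hA' h
    have himage : (Finset.univ.image (τ i₀)).image f' = Finset.univ.image fun a => f' (τ i₀ a) := by
      rw [Finset.image_image]
      rfl
    simp only [List.mem_singleton, exists_eq_left, himage]
    rcases hq with rfl | hq
    · rw [Finset.image_empty] at h'
      exact h'.hasCover_iff_of_boundary_eq_empty hl i₀
    · refine h'.hasCover_iff hl i₀ ?_
      have := Finset.card_image_le (s := b) (f := f')
      rw [Fintype.card_fin]
      omega
  · simp only [List.mem_singleton, forall_eq]
    exact ⟨τ i₀ ⟨0, hs⟩, Finset.mem_image_of_mem _ (Finset.mem_univ _)⟩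
  · simpa using inv_pow_le_one hc _

theorem exists_admissible_of_long_path {c : ℝ} (hc : 1 ≤ c) (hlc : (l * (l + 1) : ℝ) ≤ 2 * c ^ 2)
    {V : Type*} {G : SimpleGraph V} {A : Finset V} {f : Fin R → V} {τ : ℕ → Fin R}
    (hadj : ∀ i, i + 1 < 2 * l → G.Adj (f (τ i)) (f (τ (i + 1))))
    (hinj : Set.InjOn (fun i => f (τ i)) {i | i < 2 * l}) :
    ∃ L : Rule R, L.Admissible l c (pattern G A f) := by
  refine ⟨(branchPairs l).map fun e => ({τ e.1, τ e.2}, 2), ?_, ?_, ?_⟩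
  · intro n G' A' f' hA' hπ k
    rw [hasCover_iff_of_long_path (g := fun i => f' (τ i))]
    · simp [Finset.image_insert]
    · exact fun i hi => (adj_iff_of_pattern_eq hπ _ _).2 (hadj i hi)
    · exact fun i hi j hj e => hinj hi hj ((eq_iff_of_pattern_eq hπ _ _).1 e)
    · exact fun i _ => hA' _
  · simp only [List.mem_map]
    rintro _ ⟨e, -, rfl⟩
    exact Finset.insert_nonempty _ _
  · have h := length_branchPairs l
    have h' : ((branchPairs l).length : ℝ) * 2 = l * (l + 1) := by exact_mod_cast h
    rw [List.map_map]
    have : (List.map ((fun b : Finset (Fin R) × ℕ => c⁻¹ ^ b.2) ∘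
        fun e : ℕ × ℕ => ({τ e.1, τ e.2}, 2)) (branchPairs l)).sum
        = (branchPairs l).length * (c⁻¹ ^ 2) := by
      simp [Function.comp_def]
    rw [this, inv_pow, mul_inv_le_iff₀ (by positivity)]
    linarith

theorem exists_tuple {V : Type*} [DecidableEq V] (U : Finset V) (hU : U.Nonempty)
    (hR : U.card ≤ R) : ∃ f : Fin R → V, (∀ i, f i ∈ U) ∧ ∀ v ∈ U, ∃ i, f i = v := by
  obtain ⟨v₀, hv₀⟩ := hU
  have : Nonempty V := ⟨v₀⟩
  obtain ⟨e, h1, -, h3⟩ := exists_enumeration U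
  refine ⟨fun i => if (i : ℕ) < U.card then e i else v₀, fun i => ?_, fun v hv => ?_⟩
  · simp only
    split_ifs with h
    · exact h1 _ h
    · exact hv₀
  · obtain ⟨i, hi, rfl⟩ := h3 v hv
    exact ⟨⟨i, hi.trans_le hR⟩, by simp [hi]⟩

/-- In every nonempty graph there is a tuple of bounded length with an admissible rule. -/
theorem exists_admissible {c : ℝ} (hc : 1 ≤ c) (hl : 1 ≤ l) (hlc : (l * (l + 1) : ℝ) ≤ 2 * c ^ 2) :
    ∃ R : ℕ, ∀ {V : Type} (G : SimpleGraph V) (A : Finset V), A.Nonempty →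
      ∃ f : Fin R → V, (∀ i, f i ∈ A) ∧ ∃ L : Rule R, L.Admissible l c (pattern G A f) := by
  classical
  obtain ⟨t, R, hstruct⟩ := exists_small_component_or_hasTwins l (2 * l)
  refine ⟨max (2 * l) (max t R), fun {V} G A hne => ?_⟩
  by_cases hpath : ∃ p, IsPathOn G A p ∧ 2 * l < p.length
  · obtain ⟨p, hp, hlen⟩ := hpath
    obtain ⟨v₀, hv₀⟩ := hne
    have hget : ∀ i, i < p.length → p.getD i v₀ ∈ p := fun i hi => by
      rw [List.getD_eq_getElem _ _ hi]
      exact List.getElem_mem hi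
    obtain ⟨f, hfU, hf⟩ := exists_tuple (R := max (2 * l) (max t R))
      ((Finset.range (2 * l)).image fun i => p.getD i v₀)
      ⟨_, Finset.mem_image_of_mem _ (Finset.mem_range.2 (by omega : 0 < 2 * l))⟩
      (Finset.card_image_le.trans (by simp))
    have hfA : ∀ i, f i ∈ A := by
      intro i
      obtain ⟨j, hj, e⟩ := Finset.mem_image.1 (hfU i)
      rw [← e]
      exact hp.mem _ (hget j ((Finset.mem_range.1 hj).trans hlen))
    have hτ : ∀ i, ∃ j, i < 2 * l → f j = p.getD i v₀ := by
      intro i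
      by_cases hi : i < 2 * l
      · obtain ⟨j, hj⟩ := hf _ (Finset.mem_image_of_mem (fun i => p.getD i v₀)
          (Finset.mem_range.2 hi))
        exact ⟨j, fun _ => hj⟩
      · exact ⟨⟨0, by omega⟩, fun h => absurd h hi⟩
    choose τ hτ using hτ
    refine ⟨f, hfA, exists_admissible_of_long_path (τ := τ) hc hlc ?_ ?_⟩
    · intro i hi
      rw [hτ i (by omega), hτ (i + 1) hi, List.getD_eq_getElem _ _ (by omega : i < p.length),
        List.getD_eq_getElem _ _ (by omega : i + 1 < p.length)]
      exact List.isChain_iff_getElem.1 hp.chain i (by omega)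
    · intro i hi j hj e
      have hi' : i < 2 * l := hi
      have hj' : j < 2 * l := hj
      simp only at e
      rw [hτ i hi', hτ j hj', List.getD_eq_getElem _ _ (by omega : i < p.length),
        List.getD_eq_getElem _ _ (by omega : j < p.length)] at e
      exact (hp.nodup.getElem_inj_iff).1 e
  · push Not at hpath
    rcases hstruct G A hne hpath with ⟨C, hCA, hCne, hCt, hclosed⟩ |
      ⟨B, q, s, H, t', htw, hq, hs, hR⟩
    · obtain ⟨f, hfU, hf⟩ := exists_tuple (R := max (2 * l) (max t R)) C hCne (by omega)
      have : Nonempty V := ⟨hCne.choose⟩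
      obtain ⟨e, he1, he2, he3⟩ := exists_enumeration C
      choose τ hτ using fun a : Fin C.card => hf (e a) (he1 a a.2)
      refine ⟨f, fun i => hCA (hfU i), exists_admissible_of_twins (q := 1) (b := ∅)
        (H := G.comap fun a : Fin C.card => e a) (τ := fun _ => τ) hc hl (fun i => hCA (hfU i))
        (Finset.card_pos.2 hCne) ?_ 0 (Or.inl rfl)⟩
      simp only [hτ]
      refine ⟨?_, fun _ a => hCA (he1 a a.2), by simp, fun _ a b => Iff.rfl, by simp, ?_⟩
      · intro i a j b hab
        exact ⟨Subsingleton.elim _ _, Fin.ext (he2 _ a.2 _ b.2 hab)⟩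
      · intro _ a w hw hadj
        obtain ⟨m, hm, rfl⟩ := he3 w (hclosed _ (he1 a a.2) w hw hadj)
        exact Or.inr ⟨⟨m, hm⟩, rfl⟩
    · -- The part of the boundary outside `A` plays no role.
      have hBA := Finset.card_le_card (Finset.inter_subset_right : A ∩ B ⊆ B)
      set U : Finset V := (A ∩ B) ∪ Finset.univ.image fun x : Fin q × Fin s => t' x.1 x.2 with hU
      have htU : ∀ i a, t' i a ∈ U := fun i a =>
        Finset.mem_union_right _ (Finset.mem_image.2 ⟨(i, a), Finset.mem_univ _, rfl⟩)
      have hUA : ∀ v ∈ U, v ∈ A := by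
        intro v hv
        rcases Finset.mem_union.1 hv with hv | hv
        · exact (Finset.mem_inter.1 hv).1
        · obtain ⟨x, -, rfl⟩ := Finset.mem_image.1 hv
          exact htw.mem _ _
      let i₀ : Fin q := ⟨0, by omega⟩
      obtain ⟨f, hfU, hf⟩ := exists_tuple (R := max (2 * l) (max t R)) U ⟨_, htU i₀ ⟨0, hs⟩⟩ (by
        have h1 := Finset.card_union_le (A ∩ B)
          (Finset.univ.image fun x : Fin q × Fin s => t' x.1 x.2)
        have h2 := Finset.card_image_le (s := (Finset.univ : Finset (Fin q × Fin s)))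
          (f := fun x => t' x.1 x.2)
        rw [Finset.card_univ, Fintype.card_prod, Fintype.card_fin, Fintype.card_fin] at h2
        rw [← hU] at h1
        omega)
      have : Nonempty (Fin (max (2 * l) (max t R))) := ⟨⟨0, by omega⟩⟩
      choose! g hg using hf
      have himage : ((A ∩ B).image g).image f = A ∩ B := by
        rw [Finset.image_image]
        refine (Finset.image_congr fun v hv => ?_).trans Finset.image_id
        exact hg v (Finset.mem_union_left _ hv)
      refine ⟨f, fun i => hUA _ (hfU i), exists_admissible_of_twins (b := (A ∩ B).image g)
        (H := H) (τ := fun i a => g (t' i a)) hc hl (fun i => hUA _ (hfU i)) hs ?_ i₀ (Or.inr ?_)⟩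
      · rw [himage]
        simp only [hg _ (htU _ _)]
        exact ⟨htw.inj, htw.mem, fun i a h => htw.notMem i a (Finset.mem_inter.1 h).2, htw.adj,
          fun i j a v hv => htw.adj_boundary i j a v (Finset.mem_inter.1 hv).2,
          fun i a w hw hadj => (htw.closed i a w hw hadj).imp
            (fun h => Finset.mem_inter.2 ⟨hw, h⟩) id⟩
      · have := Finset.card_image_le (s := A ∩ B) (f := g)
        omega

end Rules

end PathCover

namespace TreeLang

/-! ### Functions on trees that are computable in polynomial time -/

open Polynomial

/-- The number of nodes of a tree, leaves included. -/
def Data.size : Data → ℕ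
  | .nil => 1
  | .cons a b => a.size + b.size + 1

/-- The entries of the list that a tree represents; every tree represents a list. -/
def Data.toList : Data → List Data
  | .nil => []
  | .cons a b => a :: b.toList

@[simp] theorem Data.toList_ofList (L : List Data) : (Data.ofList L).toList = L := by
  induction L with
  | nil => rfl
  | cons a L ih => simp [Data.ofList, Data.toList, ih]

@[simp] theorem Data.ofList_toList (d : Data) : Data.ofList d.toList = d := by
  induction d with
  | nil => rfl
  | cons a b _ ih => simp [Data.ofList, Data.toList, ih]

theorem Data.one_le_size (d : Data) : 1 ≤ d.size := by
  cases d <;> simp [Data.size]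

theorem Data.size_hd_le (d : Data) : d.hd.size ≤ d.size := by
  cases d <;> simp [Data.size, Data.hd]
  omega

theorem Data.size_tl_le (d : Data) : d.tl.size ≤ d.size := by
  cases d <;> simp [Data.size, Data.tl]
  omega

theorem Data.size_ofList (L : List Data) :
    (Data.ofList L).size = 1 + (L.map fun a => a.size + 1).sum := by
  induction L with
  | nil => rfl
  | cons a L ih => simp [Data.ofList, Data.size, ih]; omega

theorem Data.size_le_of_mem {a d : Data} (h : a ∈ d.toList) : a.size ≤ d.size := by
  induction d with
  | nil => simp [Data.toList] at h
  | cons b d _ ih =>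
    rcases List.mem_cons.1 h with rfl | h
    · simp [Data.size]; omega
    · have := ih h
      simp [Data.size]; omega

theorem Data.length_toList_le (d : Data) : d.toList.length + 1 ≤ d.size := by
  induction d with
  | nil => simp [Data.toList, Data.size]
  | cons a d _ ih =>
    simp only [Data.toList, List.length_cons, Data.size]
    omega

theorem eval_mono (p : ℕ[X]) {m n : ℕ} (h : m ≤ n) : p.eval m ≤ p.eval n := by
  rw [eval_eq_sum_range, eval_eq_sum_range]
  exact Finset.sum_le_sum fun i _ => Nat.mul_le_mul_left _ (Nat.pow_le_pow_left h i)

/-- The functions of the program `Q` occur in the program `P` as a block that starts at number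
`o`. -/
def CodeAt (P : Program) (o : ℕ) (Q : Program) : Prop :=
  ∀ (i : ℕ) (b : Exp), Q[i]? = some b → P[o + i]? = some b

theorem CodeAt.left {P : Program} {o : ℕ} {Q Q' : Program} (h : CodeAt P o (Q ++ Q')) :
    CodeAt P o Q := by
  intro i b hb
  refine h i b ?_
  have hi : i < Q.length := (List.getElem?_eq_some_iff.1 hb).1
  rwa [List.getElem?_append_left hi]

theorem CodeAt.right {P : Program} {o : ℕ} {Q Q' : Program} (h : CodeAt P o (Q ++ Q')) :
    CodeAt P (o + Q.length) Q' := by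
  intro i b hb
  rw [add_assoc]
  refine h _ b ?_
  rwa [List.getElem?_append_right (by omega), Nat.add_sub_cancel_left]

theorem CodeAt.append (P Q : Program) : CodeAt (P ++ Q) P.length Q := by
  intro i b hb
  rwa [List.getElem?_append_right (by omega), Nat.add_sub_cancel_left]

/-- `F` is computed in polynomial time by relocatable code: wherever the auxiliary functions `Q o`
are placed in a program, the expression `e o` computes `F` of variable `0`. The size of the value
is bounded too, since shared subtrees may make it exponential in the time. -/
def PolyTime (F : Data → Data) : Prop :=
  ∃ (Q : ℕ → Program) (e : ℕ → Exp) (p : ℕ[X]), (∀ x, (F x).size ≤ p.eval x.size) ∧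
    ∀ (P : Program) (o : ℕ), CodeAt P o (Q o) → ∀ (x : Data) (env : List Data),
      ∃ t, Eval P (x :: env) (e o) (F x) t ∧ t ≤ p.eval x.size

namespace PolyTime

variable {F G L : Data → Data}

protected theorem id : PolyTime fun x => x :=
  ⟨fun _ => [], fun _ => .var 0, X + 1, fun x => by simp, fun P o _ x env =>
    ⟨1, .var rfl, by simp⟩⟩

theorem nil : PolyTime fun _ => .nil :=
  ⟨fun _ => [], fun _ => .nil, 1, fun x => by simp [Data.size], fun P o _ x env =>
    ⟨1, .nil, by simp⟩⟩

theorem comp (hF : PolyTime F) (hG : PolyTime G) : PolyTime fun x => F (G x) := by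
  obtain ⟨Q, e, p, hp, h⟩ := hF
  obtain ⟨Q', e', p', hp', h'⟩ := hG
  refine ⟨fun o => Q' o ++ Q (o + (Q' o).length),
    fun o => .bind (e' o) (e (o + (Q' o).length)), p' + p.comp p' + 1, fun x => ?_,
    fun P o hP x env => ?_⟩
  · have := (hp (G x)).trans (eval_mono p (hp' x))
    simp only [eval_add, eval_comp, eval_one]
    omega
  · obtain ⟨t', ht', hle'⟩ := h' P o hP.left x env
    obtain ⟨t, ht, hle⟩ := h P _ hP.right (G x) (x :: env)
    refine ⟨_, .bind ht' ht, ?_⟩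
    have := hle.trans (eval_mono p (hp' x))
    simp only [eval_add, eval_comp, eval_one]
    omega

theorem cons (hF : PolyTime F) (hG : PolyTime G) : PolyTime fun x => .cons (F x) (G x) := by
  obtain ⟨Q, e, p, hp, h⟩ := hF
  obtain ⟨Q', e', p', hp', h'⟩ := hG
  refine ⟨fun o => Q o ++ Q' (o + (Q o).length),
    fun o => .cons (e o) (e' (o + (Q o).length)), p + p' + 1, fun x => ?_, fun P o hP x env => ?_⟩
  · have := hp x
    have := hp' x
    simp only [eval_add, eval_one, Data.size]
    omega
  · obtain ⟨t, ht, hle⟩ := h P o hP.left x env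
    obtain ⟨t', ht', hle'⟩ := h' P _ hP.right x env
    refine ⟨_, .cons ht ht', ?_⟩
    simp only [eval_add, eval_one]
    omega

theorem hd (hF : PolyTime F) : PolyTime fun x => (F x).hd := by
  obtain ⟨Q, e, p, hp, h⟩ := hF
  refine ⟨Q, fun o => .hd (e o), p + 1, fun x => ?_, fun P o hP x env => ?_⟩
  · have := hp x
    have := (F x).size_hd_le
    simp only [eval_add, eval_one]
    omega
  · obtain ⟨t, ht, hle⟩ := h P o hP x env
    refine ⟨_, .hd ht, ?_⟩
    simp only [eval_add, eval_one]
    omega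

theorem tl (hF : PolyTime F) : PolyTime fun x => (F x).tl := by
  obtain ⟨Q, e, p, hp, h⟩ := hF
  refine ⟨Q, fun o => .tl (e o), p + 1, fun x => ?_, fun P o hP x env => ?_⟩
  · have := hp x
    have := (F x).size_tl_le
    simp only [eval_add, eval_one]
    omega
  · obtain ⟨t, ht, hle⟩ := h P o hP x env
    refine ⟨_, .tl ht, ?_⟩
    simp only [eval_add, eval_one]
    omega

open Classical in
theorem iteNil {C : Data → Data} (hC : PolyTime C) (hF : PolyTime F) (hG : PolyTime G) :
    PolyTime fun x => if C x = .nil then F x else G x := by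
  obtain ⟨Q, e, p, hp, h⟩ := hC
  obtain ⟨Q₁, e₁, p₁, hp₁, h₁⟩ := hF
  obtain ⟨Q₂, e₂, p₂, hp₂, h₂⟩ := hG
  refine ⟨fun o => Q o ++ (Q₁ (o + (Q o).length) ++
      Q₂ (o + (Q o).length + (Q₁ (o + (Q o).length)).length)),
    fun o => .ite (e o) (e₂ (o + (Q o).length + (Q₁ (o + (Q o).length)).length))
      (e₁ (o + (Q o).length)), p + p₁ + p₂ + 1, fun x => ?_, fun P o hP x env => ?_⟩
  · have := hp₁ x
    have := hp₂ x
    simp only [eval_add, eval_one]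
    split_ifs <;> omega
  · obtain ⟨t, ht, hle⟩ := h P o hP.left x env
    obtain ⟨t₁, ht₁, hle₁⟩ := h₁ P _ hP.right.left x env
    obtain ⟨t₂, ht₂, hle₂⟩ := h₂ P _ hP.right.right x env
    simp only [eval_add, eval_one]
    cases hCx : C x with
    | nil =>
      rw [hCx] at ht
      exact ⟨_, by simpa using Eval.iteFalse ht ht₁, by omega⟩
    | cons a b =>
      rw [hCx] at ht
      exact ⟨_, by simpa using Eval.iteTrue ht ht₂, by omega⟩

/-- Recursion along a list, with an a priori bound on the size of the intermediate values. -/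
theorem foldr {F : Data → Data → Data → Data} {Z : Data → Data}
    (hF : PolyTime fun y => F y.hd y.tl.hd y.tl.tl) (hZ : PolyTime Z) (hL : PolyTime L) (b : ℕ[X])
    (hb : ∀ x l, l <:+ (L x).toList → (l.foldr (F x) (Z x)).size ≤ b.eval x.size) :
    PolyTime fun x => (L x).toList.foldr (F x) (Z x) := by
  obtain ⟨Q, e, p, hp, h⟩ := hF
  obtain ⟨Q₁, e₁, p₁, hp₁, h₁⟩ := hZ
  obtain ⟨Q₂, e₂, p₂, hp₂, h₂⟩ := hL
  let oF : ℕ → ℕ := fun o => o + 1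
  let oZ : ℕ → ℕ := fun o => oF o + (Q (oF o)).length
  let oL : ℕ → ℕ := fun o => oZ o + (Q₁ (oZ o)).length
  -- The auxiliary function with number `o` takes the pair of `x` and the rest of the list.
  let body : ℕ → Exp := fun o =>
    .ite (.tl (.var 0))
      (.bind (.cons (.hd (.var 0)) (.cons (.hd (.tl (.var 0)))
        (.call o (.cons (.hd (.var 0)) (.tl (.tl (.var 0))))))) (e (oF o)))
      (.bind (.hd (.var 0)) (e₁ (oZ o)))
  refine ⟨fun o => [body o] ++ (Q (oF o) ++ (Q₁ (oZ o) ++ Q₂ (oL o))),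
    fun o => .bind (.cons (.var 0) (e₂ (oL o))) (.call o (.var 0)),
    b + p₂ + p₂ * (30 + p.comp (2 + X + p₂ + b) + p₁) + 10, fun x => ?_, fun P o hP x env => ?_⟩
  · have := hb x _ List.suffix_rfl
    simp only [eval_add]
    omega
  · have hbody : P[o]? = some (body o) := hP 0 (body o) rfl
    have hF' := h P (oF o) hP.right.left
    have hZ' := h₁ P (oZ o) hP.right.right.left
    obtain ⟨tL, htL, hleL⟩ := h₂ P (oL o) hP.right.right.right x env
    set K := 30 + p.eval (2 + x.size + p₂.eval x.size + b.eval x.size) + p₁.eval x.size with hK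
    have key : ∀ d : Data, d.toList <:+ (L x).toList →
        ∃ t, Eval P [.cons x d] (body o) (d.toList.foldr (F x) (Z x)) t ∧ t ≤ d.size * K := by
      intro d
      induction d with
      | nil =>
        intro _
        obtain ⟨t, ht, hle⟩ := hZ' x [.cons x .nil]
        refine ⟨_, .iteFalse (.tl (v := .cons x .nil) (.var rfl))
          (.bind (.hd (v := .cons x .nil) (.var rfl)) ht), ?_⟩
        simp only [Data.size]
        omega
      | cons a d _ ih =>
        intro hsuf
        have hsuf' : d.toList <:+ (L x).toList := (List.suffix_cons a d.toList).trans hsuf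
        obtain ⟨t, ht, hle⟩ := ih hsuf'
        set acc := d.toList.foldr (F x) (Z x) with hacc
        obtain ⟨t', ht', hle'⟩ := hF' (.cons x (.cons a acc)) [.cons x (.cons a d)]
        have hv : Eval P [Data.cons x (.cons a d)] (.var 0) (.cons x (.cons a d)) 1 := .var rfl
        refine ⟨_, .iteTrue (x := a) (y := d) hv.tl (.bind (.cons hv.hd (.cons hv.tl.hd
          (.call (.cons hv.hd hv.tl.tl) hbody ht))) ht'), ?_⟩
        have hsize : (Data.cons x (.cons a acc)).size
            ≤ 2 + x.size + p₂.eval x.size + b.eval x.size := by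
          have h1 : acc.size ≤ b.eval x.size := hb x _ hsuf'
          have h2 := (Data.size_le_of_mem (hsuf.subset (List.mem_cons_self (a := a)))).trans (hp₂ x)
          simp only [Data.size]
          omega
        have hle'' := hle'.trans (eval_mono p hsize)
        have : d.size * K + K ≤ (Data.cons a d).size * K := by
          rw [← Nat.succ_mul]
          refine Nat.mul_le_mul_right _ ?_
          simp only [Data.size]
          omega
        omega
    obtain ⟨t, ht, hle⟩ := key (L x) List.suffix_rfl
    refine ⟨_, .bind (.cons (.var rfl) htL) (.call (.var rfl) hbody ht), ?_⟩
    have : (L x).size * K ≤ p₂.eval x.size * K := Nat.mul_le_mul_right _ (hp₂ x)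
    simp only [eval_add, eval_mul, eval_comp, eval_X, eval_ofNat, ← hK]
    omega

theorem append (hF : PolyTime F) (hG : PolyTime G) :
    PolyTime fun x => Data.ofList ((F x).toList ++ (G x).toList) := by
  have heq : ∀ x, ∀ l : List Data, l.foldr (fun a acc => Data.cons a acc) (G x)
      = Data.ofList (l ++ (G x).toList) := by
    intro x l
    induction l with
    | nil => simp
    | cons a l ih => simp [ih, Data.ofList]
  obtain ⟨_, _, p, hp, -⟩ := id hF
  obtain ⟨_, _, p', hp', -⟩ := id hG
  simp only [← heq]
  refine foldr (F := fun _ a acc => .cons a acc) ((PolyTime.id.tl.hd).cons PolyTime.id.tl.tl)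
    hG hF (p + p') fun x l hl => ?_
  rw [heq, Data.size_ofList]
  have h1 : (l.map fun a => a.size + 1).sum ≤ ((F x).toList.map fun a => a.size + 1).sum :=
    (hl.sublist.map _).sum_le_sum (by simp)
  have h2 := Data.size_ofList (F x).toList
  have h3 := Data.size_ofList (G x).toList
  have h4 := hp x
  have h5 := hp' x
  simp only [Data.ofList_toList] at h2 h3
  simp only [List.map_append, List.sum_append, eval_add]
  omega

/-- The list comprehension `F x a` with `a` from `L x`, for a function `F` with lists as values. -/
theorem flatMap {F : Data → Data → Data} (hF : PolyTime fun y => F y.hd y.tl) (hL : PolyTime L) :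
    PolyTime fun x => Data.ofList ((L x).toList.flatMap fun a => (F x a).toList) := by
  have heq : ∀ x, ∀ l : List Data,
      l.foldr (fun a acc => Data.ofList ((F x a).toList ++ acc.toList)) .nil
        = Data.ofList (l.flatMap fun a => (F x a).toList) := by
    intro x l
    induction l with
    | nil => rfl
    | cons a l ih => simp [ih]
  obtain ⟨_, _, p, hp, -⟩ := id hF
  obtain ⟨_, _, p', hp', -⟩ := id hL
  simp only [← heq]
  refine foldr (F := fun x a acc => Data.ofList ((F x a).toList ++ acc.toList))
    (append (F := fun y => F y.hd y.tl.hd) (G := fun y => y.tl.tl)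
      (hF.comp (PolyTime.id.hd.cons PolyTime.id.tl.hd)) PolyTime.id.tl.tl) nil hL
    (1 + p' * p.comp (X + p' + 1)) fun x l hl => ?_
  have hsz : ∀ l : List Data, (Data.ofList (l.flatMap fun a => (F x a).toList)).size
      ≤ 1 + (l.map fun a => (F x a).size).sum := by
    intro l
    rw [Data.size_ofList]
    induction l with
    | nil => simp
    | cons a l ih =>
      have h2 := Data.size_ofList (F x a).toList
      simp only [Data.ofList_toList] at h2
      simp only [List.flatMap_cons, List.map_append, List.sum_append, List.map_cons,
        List.sum_cons]
      omega
  have hmem : ∀ m ∈ l.map fun a => (F x a).size, m ≤ p.eval (x.size + p'.eval x.size + 1) := by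
    intro m hm
    obtain ⟨a, ha, rfl⟩ := List.mem_map.1 hm
    refine (hp (.cons x a)).trans (eval_mono p ?_)
    have := (Data.size_le_of_mem (hl.subset ha)).trans (hp' x)
    simp only [Data.size]
    omega
  have h1 := List.sum_le_card_nsmul _ _ hmem
  have h2 := hl.length_le
  have h3 := (L x).length_toList_le
  have h4 := hp' x
  rw [List.length_map, smul_eq_mul] at h1
  have h5 := Nat.mul_le_mul_right (p.eval (x.size + p'.eval x.size + 1))
    (show l.length ≤ p'.eval x.size by omega)
  have h6 := hsz l
  rw [heq]
  simp only [eval_add, eval_mul, eval_comp, eval_X, eval_one]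
  omega

theorem map {F : Data → Data → Data} (hF : PolyTime fun y => F y.hd y.tl) (hL : PolyTime L) :
    PolyTime fun x => Data.ofList ((L x).toList.map (F x)) := by
  have := flatMap (F := fun x a => .cons (F x a) .nil) (hF.cons nil) hL
  simpa only [Data.toList, ← List.map_eq_flatMap] using this

/-- Removal of as many entries from the list `L x` as the list `F x` has. -/
theorem drop (hF : PolyTime F) (hL : PolyTime L) :
    PolyTime fun x => Data.ofList ((L x).toList.drop (F x).toList.length) := by
  have hdrop : ∀ (d : Data) (n : ℕ),
      (Data.ofList (d.toList.drop n)).tl = Data.ofList (d.toList.drop (n + 1)) := by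
    intro d n
    rw [← List.drop_drop]
    cases d.toList.drop n <;> rfl
  have heq : ∀ x, ∀ l : List Data, l.foldr (fun _ acc => acc.tl) (L x)
      = Data.ofList ((L x).toList.drop l.length) := by
    intro x l
    induction l with
    | nil => simp
    | cons a l ih => simp [ih, hdrop]
  obtain ⟨_, _, p, hp, -⟩ := id hL
  simp only [← heq]
  refine foldr (F := fun _ _ acc => acc.tl) PolyTime.id.tl.tl.tl hL hF p fun x l _ => ?_
  rw [heq, Data.size_ofList]
  have h1 : (((L x).toList.drop l.length).map fun a => a.size + 1).sum
      ≤ ((L x).toList.map fun a => a.size + 1).sum :=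
    ((List.drop_sublist _ _).map _).sum_le_sum (by simp)
  have h2 := Data.size_ofList (L x).toList
  rw [Data.ofList_toList] at h2
  have := hp x
  omega

end PolyTime

/-- The predicate `p` is decided in polynomial time, by a function whose value is `nil` exactly
where `p` fails. -/
def PolyPred (p : Data → Prop) : Prop :=
  ∃ C : Data → Data, PolyTime C ∧ ∀ x, p x ↔ C x ≠ .nil

open Classical in
theorem PolyTime.ite {p : Data → Prop} {F G : Data → Data} (hp : PolyPred p) (hF : PolyTime F)
    (hG : PolyTime G) : PolyTime fun x => if p x then F x else G x := by
  obtain ⟨C, hC, hpC⟩ := hp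
  simp only [hpC, ne_eq, ite_not]
  exact hC.iteNil hG hF

namespace PolyPred

variable {p q : Data → Prop} {F G L : Data → Data}

open Classical in
theorem isNil (hF : PolyTime F) : PolyPred fun x => F x = .nil :=
  ⟨_, hF.iteNil (PolyTime.nil.cons PolyTime.nil) PolyTime.nil, fun x => by split_ifs <;> simp_all⟩

open Classical in
theorem not (hp : PolyPred p) : PolyPred fun x => ¬ p x :=
  ⟨_, PolyTime.ite hp PolyTime.nil (PolyTime.nil.cons PolyTime.nil), fun x => by
    split_ifs <;> simp_all⟩

open Classical in
theorem or (hp : PolyPred p) (hq : PolyPred q) : PolyPred fun x => p x ∨ q x := by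
  obtain ⟨C, hC, hqC⟩ := hq
  exact ⟨_, PolyTime.ite hp (PolyTime.nil.cons PolyTime.nil) hC, fun x => by
    split_ifs <;> simp_all⟩

theorem imp (hp : PolyPred p) (hq : PolyPred q) : PolyPred fun x => p x → q x := by
  simpa only [imp_iff_not_or] using hp.not.or hq

theorem and (hp : PolyPred p) (hq : PolyPred q) : PolyPred fun x => p x ∧ q x := by
  simpa only [not_or, not_not] using (hp.not.or hq.not).not

theorem const (P : Prop) : PolyPred fun _ => P := by
  by_cases hP : P
  · exact ⟨_, PolyTime.nil.cons PolyTime.nil, fun x => by simpa using hP⟩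
  · exact ⟨_, PolyTime.nil, fun x => by simpa using hP⟩

open Classical in
theorem any {p : Data → Data → Prop} (hp : PolyPred fun y => p y.hd y.tl) (hL : PolyTime L) :
    PolyPred fun x => ∃ a ∈ (L x).toList, p x a := by
  refine ⟨_, PolyTime.flatMap (F := fun x a => if p x a then .cons .nil .nil else .nil)
    (PolyTime.ite hp (PolyTime.nil.cons PolyTime.nil) PolyTime.nil) hL, fun x => ?_⟩
  have : ∀ l : List Data, Data.ofList l ≠ .nil ↔ l ≠ [] := by
    intro l
    cases l <;> simp [Data.ofList]
  rw [this, ne_eq, List.flatMap_eq_nil_iff]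
  push Not
  refine exists_congr fun a => and_congr_right fun _ => ?_
  split_ifs with h <;> simp [h, Data.toList]

theorem all {p : Data → Data → Prop} (hp : PolyPred fun y => p y.hd y.tl) (hL : PolyTime L) :
    PolyPred fun x => ∀ a ∈ (L x).toList, p x a := by
  have := (any (p := fun x a => ¬ p x a) hp.not hL).not
  push Not at this
  exact this

theorem lengthLe (hF : PolyTime F) (hG : PolyTime G) :
    PolyPred fun x => (F x).toList.length ≤ (G x).toList.length := by
  have h := isNil (hG.drop hF)
  have hnil : ∀ l : List Data, Data.ofList l = .nil ↔ l = [] := by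
    intro l
    cases l <;> simp [Data.ofList]
  simpa only [hnil, List.drop_eq_nil_iff] using h

theorem lengthEq (hF : PolyTime F) (hG : PolyTime G) :
    PolyPred fun x => (F x).toList.length = (G x).toList.length := by
  simpa only [← le_antisymm_iff] using (lengthLe hF hG).and (lengthLe hG hF)

theorem forall_finset {κ : Type*} {p : κ → Data → Prop} (hp : ∀ i, PolyPred (p i))
    (s : Finset κ) : PolyPred fun x => ∀ i ∈ s, p i x := by
  classical
  induction s using Finset.induction_on with
  | empty => simpa using const True
  | insert i s _ ih => simpa using (hp i).and ih

end PolyPred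

theorem PolyTime.filter {p : Data → Data → Prop} [∀ x, DecidablePred (p x)] {L : Data → Data}
    (hp : PolyPred fun y => p y.hd y.tl) (hL : PolyTime L) :
    PolyTime fun x => Data.ofList ((L x).toList.filter fun a => p x a) := by
  classical
  have h := PolyTime.flatMap (F := fun x a => if p x a then .cons a .nil else .nil)
    (by convert PolyTime.ite hp (PolyTime.id.tl.cons PolyTime.nil) PolyTime.nil) hL
  convert h using 3 with x
  generalize (L x).toList = l
  induction l with
  | nil => rfl
  | cons a l ih => by_cases ha : p x a <;> simp [ha, ih, Data.toList]

/-- A case distinction by finitely many predicates that are decided in polynomial time. -/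
theorem PolyTime.cases {κ : Type*} [Finite κ] {p : κ → Data → Prop} (hp : ∀ i, PolyPred (p i))
    {Φ : (κ → Prop) → Data → Data} (hΦ : ∀ π, PolyTime (Φ π)) :
    PolyTime fun x => Φ (fun i => p i x) x := by
  classical
  have := Fintype.ofFinite κ
  have key : ∀ s : Finset κ, ∀ Φ : (κ → Prop) → Data → Data, (∀ π, PolyTime (Φ π)) →
      PolyTime fun x => Φ (fun i => i ∈ s ∧ p i x) x := by
    intro s
    induction s using Finset.induction_on with
    | empty => exact fun Φ hΦ => by simpa using hΦ _
    | insert j s hj ih =>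
      intro Φ hΦ
      have h := PolyTime.ite (hp j) (ih (fun π => Φ (Function.update π j True)) fun π => hΦ _)
        (ih Φ hΦ)
      convert h using 2 with x
      split_ifs with hx
      · congr 1
        ext i
        by_cases hij : i = j
        · subst hij
          simp [hx]
        · simp [hij]
      · congr 1
        ext i
        by_cases hij : i = j
        · subst hij
          simp [hx]
        · simp [hij]
  simpa using key Finset.univ Φ hΦ

theorem PolyTime.iterate_tl {F : Data → Data} (hF : PolyTime F) (m : ℕ) :
    PolyTime fun x => Data.tl^[m] (F x) := by
  induction m with
  | zero => exact hF
  | succ m ih =>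
    simp only [Function.iterate_succ_apply']
    exact ih.tl

/-- All lists of length `r` with entries from a given list. -/
def tuples : ℕ → Data → Data
  | 0, _ => .cons .nil .nil
  | r + 1, x => Data.ofList (x.toList.flatMap fun a => (tuples r x).toList.map (Data.cons a))

theorem polyTime_tuples (r : ℕ) : PolyTime (tuples r) := by
  induction r with
  | zero => exact PolyTime.nil.cons PolyTime.nil
  | succ r ih =>
    have h := PolyTime.flatMap (L := fun x => x)
      (F := fun x a => Data.ofList ((tuples r x).toList.map (Data.cons a)))
      (PolyTime.map (F := fun y b => .cons y.tl b) (L := fun y => tuples r y.hd)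
        (PolyTime.id.hd.tl.cons PolyTime.id.tl) (ih.comp PolyTime.id.hd)) PolyTime.id
    simp only [Data.toList_ofList] at h
    exact h

theorem mem_tuples {r : ℕ} {x d : Data} :
    d ∈ (tuples r x).toList ↔ ∃ f : Fin r → Data, (∀ i, f i ∈ x.toList) ∧
      d = Data.ofList (List.ofFn f) := by
  induction r generalizing d with
  | zero => simp [tuples, Data.toList, Data.ofList]
  | succ r ih =>
    simp only [tuples, Data.toList_ofList, List.mem_flatMap, List.mem_map, ih]
    constructor
    · rintro ⟨a, ha, _, ⟨f, hf, rfl⟩, rfl⟩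
      refine ⟨Fin.cons a f, fun i => ?_, by simp [Data.ofList]⟩
      refine Fin.cases ?_ ?_ i <;> simp [ha, hf]
    · rintro ⟨f, hf, rfl⟩
      exact ⟨f 0, hf 0, _, ⟨fun i => f i.succ, fun i => hf _, rfl⟩, by
        simp [List.ofFn_succ, Data.ofList]⟩

/-! ### Search trees -/

/-- The body of the function that decides a node of the search tree with the expansion `e`; its
number is `1`. -/
def solveBody (e : Exp) : Exp :=
  .bind e (.ite (.hd (.var 0)) (.cons .nil .nil) (.call 2 (.tl (.var 0))))

/-- The body of the function that looks for a positive node in a list; its number is `2`. -/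
def solveAnyBody : Exp :=
  .ite (.var 0) (.ite (.call 1 (.hd (.var 0))) (.cons .nil .nil) (.call 2 (.tl (.var 0)))) .nil

theorem length_le_sum_map {σ : Type*} {w : σ → ℝ} (hw : ∀ s, 1 ≤ w s) (cs : List σ) :
    (cs.length : ℝ) ≤ (cs.map w).sum := by
  induction cs with
  | nil => simp
  | cons c cs ih =>
    have := hw c
    simp only [List.length_cons, List.map_cons, List.sum_cons]
    push_cast
    linarith

open Classical in
/-- Depth-first search in a tree. A node `s` is given by its code `enc s`, and the function `E`,
computable in polynomial time, either accepts it or computes the list of its children. The running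
time is a polynomial in the size of the input times the weight `w s` of the root, if the weight
of each node exceeds the total weight of its children by at least one. -/
theorem exists_search {σ : Type*} {E I : Data → Data} (hE : PolyTime E) (hI : PolyTime I)
    (enc : σ → Data) (ans : σ → Prop) (w : σ → ℝ) (μ : σ → ℕ) (hw : ∀ s, 1 ≤ w s)
    (h : ∀ s, (ans s ∧ E (enc s) = .cons (.cons .nil .nil) .nil) ∨
      ∃ cs : List σ, E (enc s) = .cons .nil (Data.ofList (cs.map enc)) ∧
        (ans s ↔ ∃ c ∈ cs, ans c) ∧ (∀ c ∈ cs, μ c < μ s ∧ (enc c).size ≤ (enc s).size) ∧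
        1 + (cs.map w).sum ≤ w s) :
    ∃ (P : Program) (p : ℕ[X]), ∀ x s, I x = enc s →
      ∃ t, Runs P x (Data.ofBool (decide (ans s))) t ∧ (t : ℝ) ≤ w s * (p.eval x.size : ℕ) := by
  obtain ⟨Q, e, p, -, hE⟩ := hE
  obtain ⟨Q', e', p', hp', hI⟩ := hI
  set o := 3 + (Q 3).length with ho
  set P : Program := [.call 1 (e' o), solveBody (e 3), solveAnyBody] ++ (Q 3 ++ Q' o) with hP
  have hcode : CodeAt P 3 (Q 3 ++ Q' o) := CodeAt.append _ _
  have h0 : P[0]? = some (.call 1 (e' o)) := rfl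
  have h1 : P[1]? = some (solveBody (e 3)) := rfl
  have h2 : P[2]? = some solveAnyBody := rfl
  refine ⟨P, p' + 30 + p.comp p', fun x s hs => ?_⟩
  set K := p.eval (p'.eval x.size) + 25 with hK
  have key : ∀ m s, μ s < m → (enc s).size ≤ p'.eval x.size →
      ∃ t, Eval P [enc s] (solveBody (e 3)) (Data.ofBool (decide (ans s))) t ∧
        (t : ℝ) + 10 ≤ w s * K := by
    intro m
    induction m with
    | zero => exact fun s hs => absurd hs (Nat.not_lt_zero _)
    | succ m ih =>
      intro s hsm hsize
      obtain ⟨t, ht, hle⟩ := hE P 3 hcode.left (enc s) []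
      have hle' : (t : ℝ) + 25 ≤ K := by
        have := hle.trans (eval_mono p hsize)
        have : t + 25 ≤ K := by omega
        exact_mod_cast this
      have hK0 : (0 : ℝ) ≤ K := Nat.cast_nonneg _
      rcases h s with ⟨hans, hEs⟩ | ⟨cs, hEs, hans, hcs, hsum⟩
      · rw [hEs] at ht
        refine ⟨_, .bind ht (.iteTrue (.hd (v := .cons (.cons .nil .nil) .nil) (.var rfl))
          (by simpa [hans, Data.ofBool] using Eval.cons .nil .nil)), ?_⟩
        have := mul_le_mul_of_nonneg_right (hw s) hK0
        push_cast
        linarith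
      · rw [hEs] at ht
        have hany : ∀ ds : List σ, (∀ c ∈ ds, μ c < μ s ∧ (enc c).size ≤ (enc s).size) →
            ∃ t, Eval P [Data.ofList (ds.map enc)] solveAnyBody
              (Data.ofBool (decide (∃ c ∈ ds, ans c))) t ∧ (t : ℝ) ≤ (ds.map w).sum * K + 3 := by
          intro ds
          induction ds with
          | nil =>
            intro _
            exact ⟨_, .iteFalse (.var rfl) (by simpa [Data.ofBool] using Eval.nil), by norm_num⟩
          | cons c ds ihds =>
            intro hds
            obtain ⟨t₁, ht₁, hle₁⟩ := ih c (by have := (hds c (by simp)).1; omega)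
              ((hds c (by simp)).2.trans hsize)
            obtain ⟨t₂, ht₂, hle₂⟩ := ihds fun d hd => hds d (List.mem_cons_of_mem _ hd)
            have hv : Eval P [Data.ofList ((c :: ds).map enc)] (.var 0)
              (.cons (enc c) (Data.ofList (ds.map enc))) 1 := .var rfl
            have hsum0 : 0 ≤ (ds.map w).sum * K :=
              mul_nonneg ((Nat.cast_nonneg _).trans (length_le_sum_map hw ds)) hK0
            simp only [List.map_cons, List.sum_cons, add_mul]
            by_cases hc : ans c
            · simp only [hc, decide_true, Data.ofBool] at ht₁
              refine ⟨_, .iteTrue hv (.iteTrue (.call hv.hd h1 ht₁)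
                (by simpa [hc, Data.ofBool] using Eval.cons .nil .nil)), ?_⟩
              push_cast
              linarith
            · simp only [hc, decide_false, Data.ofBool] at ht₁
              refine ⟨_, .iteTrue hv (.iteFalse (.call hv.hd h1 ht₁)
                (by simpa [hc] using Eval.call hv.tl h2 ht₂)), ?_⟩
              push_cast
              linarith
        obtain ⟨t', ht', hle''⟩ := hany cs hcs
        have hv : Eval P (Data.cons .nil (Data.ofList (cs.map enc)) :: [enc s]) (.var 0)
          (.cons .nil (Data.ofList (cs.map enc))) 1 := .var rfl
        refine ⟨_, .bind ht (.iteFalse hv.hd (by simpa [hans] using Eval.call hv.tl h2 ht')), ?_⟩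
        have := mul_le_mul_of_nonneg_right hsum hK0
        push_cast
        linarith
  obtain ⟨t, ht, hle⟩ := hI P o hcode.right x []
  obtain ⟨t', ht', hle'⟩ := key (μ s + 1) s (Nat.lt_succ_self _) (hs ▸ hp' x)
  rw [hs] at ht
  refine ⟨_, .call (.var rfl) h0 (.call ht h1 ht'), ?_⟩
  have h3 : (t : ℝ) ≤ (p'.eval x.size : ℕ) := by exact_mod_cast hle
  have h4 : (1 : ℝ) * ((p'.eval x.size : ℕ) + 5) ≤ w s * ((p'.eval x.size : ℕ) + 5) :=
    mul_le_mul_of_nonneg_right (hw s) (by positivity)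
  rw [hK] at hle'
  simp only [eval_add, eval_comp, eval_ofNat]
  push_cast at hle' ⊢
  linarith

/-! ### The branching step as a program -/

section Step

open PathCover

variable {R : ℕ}

/-- The entry number `u` of the list `d`, where the number `u` is given in unary. -/
def nth (d u : Data) : Data :=
  (Data.ofList (d.toList.drop u.toList.length)).hd

/-- The entry number `i` of the list `d`. -/
def entry (d : Data) (i : ℕ) : Data :=
  (Data.tl^[i] d).hd

/-- The pattern of the tuple `t` of vertices in the state `x`. A state consists of the adjacency
matrix, the list of the vertices that are left, and the budget in unary, plus one. -/
def treePattern (x t : Data) : Pattern R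
  | .inl (i, j) => (entry t i).toList.length = (entry t j).toList.length
  | .inr (.inl (i, j)) => nth (nth x.hd (entry t i)) (entry t j) ≠ .nil
  | .inr (.inr i) => ∀ w ∈ x.tl.hd.toList, nth (nth x.hd (entry t i)) w ≠ .nil →
      ∃ u ∈ t.toList, u.toList.length = w.toList.length

open Classical in
/-- The state after the deletion of the entries of `t` with positions in `b.1`, at cost `b.2`. -/
noncomputable def child (b : Finset (Fin R) × ℕ) (x t : Data) : Data :=
  .cons x.hd (.cons (Data.ofList (x.tl.hd.toList.filter fun v =>
    ∀ i ∈ b.1, (entry t i).toList.length ≠ v.toList.length)) (Data.tl^[b.2] x.tl.tl))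

open Classical in
/-- The list of the states in the branches of the rule `L` that do not exceed the budget. -/
noncomputable def children : Rule R → Data → Data → Data
  | [], _, _ => .nil
  | b :: L, x, t =>
    if Data.tl^[b.2] x.tl.tl = .nil then children L x t
    else .cons (child b x t) (children L x t)

open Classical in
/-- An admissible rule for the pattern `π`, if there is one. -/
noncomputable def pickRule (l : ℕ) (c : ℝ) (π : Pattern R) : Option (Rule R) :=
  if h : ∃ L : Rule R, L.Admissible l c π then some h.choose else none

theorem admissible_of_pickRule {l : ℕ} {c : ℝ} {π : Pattern R} {L : Rule R}
    (h : pickRule l c π = some L) : L.Admissible l c π := by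
  unfold pickRule at h
  split_ifs at h with hex
  obtain rfl := Option.some.inj h
  exact hex.choose_spec

theorem exists_pickRule {l : ℕ} {c : ℝ} {π : Pattern R} {L : Rule R} (h : L.Admissible l c π) :
    ∃ L', pickRule l c π = some L' :=
  ⟨_, dif_pos ⟨L, h⟩⟩

/-- The one-entry list of the list of children that an optional rule produces from the tuple `y.tl`
in the state `y.hd`. -/
noncomputable def candidate (o : Option (Rule R)) (y : Data) : Data :=
  match o with
  | none => .nil
  | some L => .cons (children L y.hd y.tl) .nil

/-- The lists of children produced by all tuples with an admissible rule. -/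
noncomputable def candidates (l : ℕ) (c : ℝ) (R : ℕ) (x : Data) : Data :=
  Data.ofList ((tuples R x.tl.hd).toList.flatMap fun t =>
    (candidate (pickRule (R := R) l c (treePattern x t)) (.cons x t)).toList)

open Classical in
/-- Accept if no tuple has an admissible rule, otherwise branch on the first one that has. -/
noncomputable def expand (l : ℕ) (c : ℝ) (R : ℕ) (x : Data) : Data :=
  if candidates l c R x = .nil then .cons (.cons .nil .nil) .nil
  else .cons .nil (candidates l c R x).hd

theorem PolyTime.nth {F G : Data → Data} (hF : PolyTime F) (hG : PolyTime G) :
    PolyTime fun x => nth (F x) (G x) :=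
  (hG.drop hF).hd

theorem PolyTime.entry {F : Data → Data} (hF : PolyTime F) (i : ℕ) :
    PolyTime fun x => entry (F x) i :=
  (hF.iterate_tl i).hd

theorem polyPred_treePattern (i : (Fin R × Fin R) ⊕ (Fin R × Fin R) ⊕ Fin R) :
    PolyPred fun y => treePattern y.hd y.tl i := by
  have hx := PolyTime.id.hd
  have ht := PolyTime.id.tl
  rcases i with ⟨i, j⟩ | ⟨i, j⟩ | i
  · exact PolyPred.lengthEq (ht.entry i) (ht.entry j)
  · exact (PolyPred.isNil ((hx.hd.nth (ht.entry i)).nth (ht.entry j))).not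
  · refine PolyPred.all (L := fun y => y.hd.tl.hd) (p := fun y w =>
      TreeLang.nth (TreeLang.nth y.hd.hd (TreeLang.entry y.tl i)) w ≠ .nil →
        ∃ u ∈ y.tl.toList, u.toList.length = w.toList.length) ?_ hx.tl.hd
    refine (PolyPred.isNil ((hx.hd.hd.nth (hx.tl.entry i)).nth ht)).not.imp ?_
    exact PolyPred.any (L := fun z => z.hd.tl)
      (p := fun z u => u.toList.length = z.tl.toList.length) (PolyPred.lengthEq ht hx.tl) hx.tl

theorem polyTime_child (b : Finset (Fin R) × ℕ) : PolyTime fun y => child b y.hd y.tl := by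
  have hx := PolyTime.id.hd
  have ht := PolyTime.id.tl
  refine hx.hd.cons (.cons ?_ (hx.tl.tl.iterate_tl _))
  refine PolyTime.filter (L := fun y => y.hd.tl.hd)
    (p := fun y v => ∀ i ∈ b.1, (entry y.tl i).toList.length ≠ v.toList.length) ?_ hx.tl.hd
  exact PolyPred.forall_finset
    (fun i : Fin R => (PolyPred.lengthEq (hx.tl.entry i) ht).not) b.1

theorem polyTime_children (L : Rule R) : PolyTime fun y => children L y.hd y.tl := by
  induction L with
  | nil => exact PolyTime.nil
  | cons b L ih =>
    exact PolyTime.ite (PolyPred.isNil (PolyTime.id.hd.tl.tl.iterate_tl _)) ih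
      ((polyTime_child b).cons ih)

theorem polyTime_candidate (o : Option (Rule R)) : PolyTime (candidate o) := by
  cases o with
  | none => exact PolyTime.nil
  | some L => exact (polyTime_children L).cons PolyTime.nil

theorem polyTime_candidates (l : ℕ) (c : ℝ) (R : ℕ) : PolyTime (candidates l c R) := by
  refine PolyTime.flatMap (L := fun x => tuples R x.tl.hd) (F := fun x t =>
    candidate (pickRule (R := R) l c (treePattern x t)) (.cons x t)) ?_
    ((polyTime_tuples R).comp PolyTime.id.tl.hd)
  have h := PolyTime.cases (fun i => polyPred_treePattern (R := R) i)
    (Φ := fun π y => candidate (pickRule (R := R) l c π) (.cons y.hd y.tl))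
    fun π => (polyTime_candidate _).comp (PolyTime.id.hd.cons PolyTime.id.tl)
  exact h

theorem polyTime_expand (l : ℕ) (c : ℝ) (R : ℕ) : PolyTime (expand l c R) :=
  (polyTime_candidates l c R).iteNil ((PolyTime.nil.cons PolyTime.nil).cons PolyTime.nil)
    (PolyTime.nil.cons (polyTime_candidates l c R).hd)

end Step

/-! ### Correctness of the branching step -/

section State

open PathCover

@[simp] theorem toList_ofNat (n : ℕ) : (Data.ofNat n).toList = List.replicate n .nil := by
  simp [Data.ofNat]

theorem tl_ofList (L : List Data) : (Data.ofList L).tl = Data.ofList L.tail := by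
  cases L <;> rfl

theorem iterate_tl_ofList (L : List Data) (m : ℕ) :
    Data.tl^[m] (Data.ofList L) = Data.ofList (L.drop m) := by
  induction m generalizing L with
  | zero => rfl
  | succ m ih => rw [Function.iterate_succ_apply, tl_ofList, ih, List.drop_tail]

theorem hd_ofList_drop {L : List Data} {m : ℕ} (h : m < L.length) :
    (Data.ofList (L.drop m)).hd = L[m] := by
  rw [List.drop_eq_getElem_cons h]
  rfl

theorem entry_ofList {L : List Data} {m : ℕ} (h : m < L.length) :
    entry (Data.ofList L) m = L[m] := by
  rw [entry, iterate_tl_ofList, hd_ofList_drop h]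

theorem nth_ofList {L : List Data} {m : ℕ} (h : m < L.length) :
    nth (Data.ofList L) (Data.ofNat m) = L[m] := by
  rw [nth, Data.toList_ofList, toList_ofNat, List.length_replicate, hd_ofList_drop h]

theorem nth_nth_ofGraph {n : ℕ} (G : SimpleGraph (Fin n)) (u v : Fin n) :
    nth (nth (Data.ofGraph G) (Data.ofNat u)) (Data.ofNat v) ≠ .nil ↔ G.Adj u v := by
  classical
  unfold Data.ofGraph
  rw [nth_ofList (by simp), List.getElem_ofFn, nth_ofList (by simp), List.getElem_ofFn]
  by_cases h : G.Adj u v <;> simp [h, Data.ofBool]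

theorem iterate_tl_ofNat (k m : ℕ) : Data.tl^[m] (Data.ofNat k) = Data.ofNat (k - m) := by
  rw [Data.ofNat, iterate_tl_ofList, List.drop_replicate, Data.ofNat]

theorem ofNat_eq_nil {k : ℕ} : Data.ofNat k = .nil ↔ k = 0 := by
  cases k <;> simp [Data.ofNat, Data.ofList, List.replicate_succ]

/-- A node of the search tree: a graph, the list of the vertices that are left, and the budget. -/
structure State where
  /-- the number of vertices of the input graph -/
  n : ℕ
  /-- the input graph -/
  G : SimpleGraph (Fin n)
  /-- the vertices that have not been deleted -/
  L : List (Fin n)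
  /-- the number of vertices that may still be deleted -/
  k : ℕ
  nodup : L.Nodup

namespace State

/-- The code of a state. The budget is stored plus one, so that `nil` stands for a budget that
is exceeded. -/
noncomputable def enc (s : State) : Data :=
  .cons (Data.ofGraph s.G) (.cons (Data.ofList (s.L.map fun v : Fin s.n => Data.ofNat v))
    (Data.ofNat (s.k + 1)))

/-- The list code of a tuple of vertices. -/
def encTuple {n R : ℕ} (f : Fin R → Fin n) : Data :=
  Data.ofList (List.ofFn fun i => Data.ofNat (f i))

theorem entry_encTuple {n R : ℕ} (f : Fin R → Fin n) (i : Fin R) :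
    entry (encTuple f) i = Data.ofNat (f i) := by
  rw [encTuple, entry_ofList (by simp), List.getElem_ofFn]

theorem treePattern_enc (s : State) {R : ℕ} (f : Fin R → Fin s.n) :
    treePattern s.enc (encTuple f) = pattern s.G s.L.toFinset f := by
  ext i
  rcases i with ⟨i, j⟩ | ⟨i, j⟩ | i
  · simp [treePattern, pattern, entry_encTuple, Fin.ext_iff]
  · simp only [treePattern, pattern, entry_encTuple]
    exact nth_nth_ofGraph s.G (f i) (f j)
  · simp only [treePattern, pattern, entry_encTuple]
    have h : s.enc.tl.hd.toList = s.L.map fun v : Fin s.n => Data.ofNat v := by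
      simp [enc, Data.tl, Data.hd]
    rw [h]
    simp only [List.mem_map, forall_exists_index, and_imp, forall_apply_eq_imp_iff₂,
      List.mem_toFinset]
    refine forall₂_congr fun w _ => imp_congr (nth_nth_ofGraph s.G (f i) w) ?_
    simp [encTuple, Fin.ext_iff]

/-- The state after the deletion of the entries of `f` with positions in `b.1`, at cost `b.2`. -/
def delete (s : State) {R : ℕ} (f : Fin R → Fin s.n) (b : Finset (Fin R) × ℕ) : State where
  n := s.n
  G := s.G
  L := s.L.filter fun v => v ∉ b.1.image f
  k := s.k - b.2
  nodup := s.nodup.filter _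

theorem child_enc (s : State) {R : ℕ} (f : Fin R → Fin s.n) {b : Finset (Fin R) × ℕ}
    (hb : b.2 ≤ s.k) : child b s.enc (encTuple f) = (s.delete f b).enc := by
  have h1 : Data.tl^[b.2] s.enc.tl.tl = Data.ofNat (s.k - b.2 + 1) := by
    rw [show s.k - b.2 + 1 = s.k + 1 - b.2 by omega]
    exact iterate_tl_ofNat _ _
  rw [child, h1]
  unfold enc delete
  simp only [Data.tl, Data.hd, Data.toList_ofList]
  congr 3
  rw [List.filter_map]
  congr 1
  refine List.filter_congr fun v _ => ?_
  simp [entry_encTuple, Fin.ext_iff]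

theorem children_enc (s : State) {R : ℕ} (f : Fin R → Fin s.n) (L : Rule R) :
    children L s.enc (encTuple f)
      = Data.ofList (((L.filter fun b => b.2 ≤ s.k).map (s.delete f)).map enc) := by
  induction L with
  | nil => rfl
  | cons b L ih =>
    have h1 : Data.tl^[b.2] s.enc.tl.tl = .nil ↔ ¬ b.2 ≤ s.k := by
      have : Data.tl^[b.2] s.enc.tl.tl = Data.ofNat (s.k + 1 - b.2) := iterate_tl_ofNat _ _
      rw [this, ofNat_eq_nil]
      omega
    by_cases hb : b.2 ≤ s.k
    · rw [children, if_neg (by rw [h1]; exact not_not.2 hb), child_enc s f hb, ih]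
      simp [hb, Data.ofList]
    · rw [children, if_pos (h1.2 hb), ih]
      simp [hb]

theorem toFinset_delete (s : State) {R : ℕ} (f : Fin R → Fin s.n) (b : Finset (Fin R) × ℕ) :
    (s.delete f b).L.toFinset = s.L.toFinset \ b.1.image f := by
  refine Finset.ext fun (v : Fin s.n) => ?_
  change v ∈ (s.L.filter fun v => v ∉ b.1.image f).toFinset ↔ v ∈ s.L.toFinset \ b.1.image f
  simp

theorem length_delete_lt (s : State) {R : ℕ} {f : Fin R → Fin s.n} (hf : ∀ i, f i ∈ s.L)
    {b : Finset (Fin R) × ℕ} (hb : b.1.Nonempty) : (s.delete f b).L.length < s.L.length := by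
  obtain ⟨i, hi⟩ := hb
  refine List.length_filter_lt_length_iff_exists.2 ⟨f i, hf i, ?_⟩
  simpa using ⟨i, hi, rfl⟩

theorem size_enc_delete_le (s : State) {R : ℕ} (f : Fin R → Fin s.n) (b : Finset (Fin R) × ℕ) :
    (s.delete f b).enc.size ≤ s.enc.size := by
  have key : ∀ (L : List (Fin s.n)) (k : ℕ), L.Sublist s.L → k ≤ s.k →
      (Data.cons (Data.ofGraph s.G) (.cons (Data.ofList (L.map fun v : Fin s.n => Data.ofNat v))
        (Data.ofNat (k + 1)))).size ≤ s.enc.size := by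
    intro L k hL hk
    have h1 : ((L.map fun v : Fin s.n => Data.ofNat v).map fun a => a.size + 1).sum
        ≤ ((s.L.map fun v : Fin s.n => Data.ofNat v).map fun a => a.size + 1).sum :=
      ((hL.map _).map _).sum_le_sum (by simp)
    simp only [enc, Data.size, Data.size_ofList, Data.ofNat, List.map_replicate,
      List.sum_replicate, smul_eq_mul] at h1 ⊢
    omega
  exact key _ _ List.filter_sublist (Nat.sub_le _ _)

/-- A state either is accepted, and has no vertices left, or is expanded by an admissible rule. -/
theorem expand_enc {l : ℕ} {c : ℝ} {R : ℕ}
    (hR : ∀ {V : Type} (G : SimpleGraph V) (A : Finset V), A.Nonempty →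
      ∃ f : Fin R → V, (∀ i, f i ∈ A) ∧ ∃ L : Rule R, L.Admissible l c (pattern G A f))
    (s : State) :
    (s.L = [] ∧ expand l c R s.enc = .cons (.cons .nil .nil) .nil) ∨
      ∃ (f : Fin R → Fin s.n) (L : Rule R), (∀ i, f i ∈ s.L) ∧
        L.Admissible l c (pattern s.G s.L.toFinset f) ∧ expand l c R s.enc =
          .cons .nil (Data.ofList (((L.filter fun b => b.2 ≤ s.k).map (s.delete f)).map enc)) := by
  have hmem : ∀ t, t ∈ (tuples R s.enc.tl.hd).toList ↔
      ∃ f : Fin R → Fin s.n, (∀ i, f i ∈ s.L) ∧ t = encTuple f := by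
    intro t
    have h : s.enc.tl.hd.toList = s.L.map fun v : Fin s.n => Data.ofNat v := by
      simp [enc, Data.tl, Data.hd]
    rw [mem_tuples, h]
    constructor
    · rintro ⟨g, hg, rfl⟩
      choose f hf hfg using fun i => List.mem_map.1 (hg i)
      exact ⟨f, hf, by simp only [encTuple, hfg]⟩
    · rintro ⟨f, hf, rfl⟩
      exact ⟨_, fun i => List.mem_map_of_mem (hf i), rfl⟩
  by_cases hnil : candidates l c R s.enc = .nil
  · refine Or.inl ⟨?_, if_pos hnil⟩
    by_contra hL
    obtain ⟨f, hf, L, hadm⟩ := hR s.G s.L.toFinset (by simpa using hL)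
    obtain ⟨L', hL'⟩ := exists_pickRule hadm
    have h := congrArg Data.toList hnil
    rw [candidates, Data.toList_ofList, show Data.nil.toList = [] from rfl,
      List.flatMap_eq_nil_iff] at h
    have h' := h (encTuple f) ((hmem _).2 ⟨f, fun i => by simpa using hf i, rfl⟩)
    rw [treePattern_enc, hL'] at h'
    simp [candidate, Data.toList] at h'
  · right
    have hhd : (candidates l c R s.enc).hd ∈ (candidates l c R s.enc).toList := by
      cases hc : candidates l c R s.enc with
      | nil => exact absurd hc hnil
      | cons a b => simp [Data.hd, Data.toList]
    have hlist := Data.toList_ofList ((tuples R s.enc.tl.hd).toList.flatMap fun t =>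
      (candidate (pickRule (R := R) l c (treePattern s.enc t)) (.cons s.enc t)).toList)
    rw [← candidates] at hlist
    obtain ⟨t, ht, hmt⟩ := List.mem_flatMap.1 (hlist ▸ hhd)
    obtain ⟨f, hf, rfl⟩ := (hmem t).1 ht
    rw [treePattern_enc] at hmt
    cases hpick : pickRule l c (pattern s.G s.L.toFinset f) with
    | none => simp [hpick, candidate, Data.toList] at hmt
    | some L =>
      rw [hpick] at hmt
      refine ⟨f, L, hf, admissible_of_pickRule hpick, ?_⟩
      rw [expand, if_neg hnil, ← children_enc]
      simpa [candidate, Data.toList, Data.hd, Data.tl] using hmt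

theorem hasCover_of_eq_nil {l : ℕ} (hl : 1 ≤ l) {s : State} (h : s.L = []) :
    HasCover l s.G s.L.toFinset s.k := by
  refine ⟨∅, by simp, fun p hp hlen => ?_⟩
  obtain ⟨v, hv⟩ := List.exists_mem_of_length_pos (l := p) (by omega)
  simpa [h] using hp.mem v hv

theorem hasCover_iff_exists_child {l : ℕ} {c : ℝ} {R : ℕ} {s : State} {f : Fin R → Fin s.n}
    (hf : ∀ i, f i ∈ s.L) {L : Rule R} (hL : L.Admissible l c (pattern s.G s.L.toFinset f)) :
    HasCover l s.G s.L.toFinset s.k ↔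
      ∃ s' ∈ (L.filter fun b => b.2 ≤ s.k).map (s.delete f),
        HasCover l s'.G s'.L.toFinset s'.k := by
  rw [hL.hasCover_iff s.n s.G s.L.toFinset f (fun i => by simpa using hf i) rfl]
  simp only [List.mem_map, List.mem_filter, decide_eq_true_eq, exists_exists_and_eq_and]
  refine exists_congr fun b => ?_
  rw [toFinset_delete, and_assoc]
  rfl

/-- The weight of a state bounds the number of nodes of the search tree below it. -/
noncomputable def weight (c : ℝ) (s : State) : ℝ := (s.L.length + 1) * c ^ s.k

theorem one_le_weight {c : ℝ} (hc : 1 ≤ c) (s : State) : 1 ≤ s.weight c :=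
  one_le_mul_of_one_le_of_one_le (by simp) (one_le_pow₀ hc)

theorem sum_weight_le {l : ℕ} {c : ℝ} (hc : 1 ≤ c) {R : ℕ} {s : State} {f : Fin R → Fin s.n}
    (hf : ∀ i, f i ∈ s.L) {L : Rule R} (hL : L.Admissible l c (pattern s.G s.L.toFinset f)) :
    1 + (((L.filter fun b => b.2 ≤ s.k).map (s.delete f)).map (weight c)).sum ≤ s.weight c := by
  have hc0 : 0 < c := by linarith
  have key : ∀ L' : Rule R, (∀ b ∈ L', b.1.Nonempty) →
      (((L'.filter fun b => b.2 ≤ s.k).map (s.delete f)).map (weight c)).sum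
        ≤ s.L.length * c ^ s.k * (L'.map fun b => c⁻¹ ^ b.2).sum := by
    intro L'
    induction L' with
    | nil => simp
    | cons b L' ih =>
      intro hne
      have ih' := ih fun b hb => hne b (List.mem_cons_of_mem _ hb)
      rw [List.map_cons, List.sum_cons, mul_add]
      by_cases hb : b.2 ≤ s.k
      · rw [List.filter_cons_of_pos (by simpa using hb), List.map_cons, List.map_cons,
          List.sum_cons]
        refine add_le_add ?_ ih'
        have h1 : ((s.delete f b).L.length : ℝ) + 1 ≤ s.L.length := by
          exact_mod_cast s.length_delete_lt hf (hne b (by simp))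
        have h2 : c ^ s.k * c⁻¹ ^ b.2 = c ^ (s.k - b.2) := by
          rw [inv_pow, ← div_eq_mul_inv, pow_sub₀ c hc0.ne' hb, div_eq_mul_inv]
        rw [mul_assoc, h2]
        exact mul_le_mul_of_nonneg_right h1 (by positivity)
      · rw [List.filter_cons_of_neg (by simpa using hb)]
        have : 0 ≤ (s.L.length : ℝ) * c ^ s.k * c⁻¹ ^ b.2 := by positivity
        linarith
  have h1 := key L hL.nonempty
  have h2 : (s.L.length : ℝ) * c ^ s.k * (L.map fun b => c⁻¹ ^ b.2).sum
      ≤ s.L.length * c ^ s.k := mul_le_of_le_one_right (by positivity) hL.sum_le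
  have h3 : 1 ≤ c ^ s.k := one_le_pow₀ hc
  rw [weight, add_mul]
  linarith

end State

end State

/-! ### The initial state -/

open PathCover

/-- The pair of the length of the list `d` in unary and of the list of all smaller numbers. -/
def numbering (d : Data) : Data :=
  d.toList.foldr (fun _ acc => .cons (.cons .nil acc.hd) (.cons acc.hd acc.tl)) (.cons .nil .nil)

theorem foldr_numbering (l : List Data) :
    l.foldr (fun _ acc => Data.cons (.cons .nil acc.hd) (.cons acc.hd acc.tl)) (.cons .nil .nil)
      = .cons (Data.ofNat l.length)
          (Data.ofList ((List.range l.length).reverse.map Data.ofNat)) := by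
  induction l with
  | nil => rfl
  | cons a l ih =>
    rw [List.foldr_cons, ih, List.length_cons, List.range_succ]
    simp [Data.hd, Data.tl, Data.ofList, Data.ofNat, List.replicate_succ]

theorem size_ofNat (n : ℕ) : (Data.ofNat n).size = 1 + n * 2 := by
  simp [Data.ofNat, Data.size_ofList, Data.size]

theorem polyTime_numbering {F : Data → Data} (hF : PolyTime F) :
    PolyTime fun x => numbering (F x) := by
  obtain ⟨_, _, p, hp, -⟩ := id hF
  refine PolyTime.foldr
    (F := fun _ _ acc => .cons (.cons .nil acc.hd) (.cons acc.hd acc.tl))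
    (Z := fun _ => .cons .nil .nil) ?_ (PolyTime.nil.cons PolyTime.nil) hF
    (3 + 2 * p + p * (2 * p + 2)) fun x l hl => ?_
  · have h := PolyTime.id.tl.tl
    exact (PolyTime.nil.cons h.hd).cons (h.hd.cons h.tl)
  · have hlen : l.length ≤ p.eval x.size := by
      have := hl.length_le
      have := (F x).length_toList_le
      have := hp x
      omega
    have hsum : (((List.range l.length).reverse.map Data.ofNat).map fun a => a.size + 1).sum
        ≤ p.eval x.size * (2 * p.eval x.size + 2) := by
      refine (List.sum_le_card_nsmul _ (2 * p.eval x.size + 2) fun m hm => ?_).trans ?_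
      · simp only [List.map_map, List.mem_map, List.mem_reverse, List.mem_range] at hm
        obtain ⟨i, hi, rfl⟩ := hm
        simp only [Function.comp_apply, size_ofNat]
        omega
      · rw [smul_eq_mul]
        exact Nat.mul_le_mul_right _ (by simpa using hlen)
    rw [foldr_numbering, Data.size, Data.size_ofList, size_ofNat]
    simp only [eval_add, eval_mul, eval_ofNat]
    omega

/-- The initial state of the search on an input. -/
def initialState (x : Data) : Data :=
  .cons x.hd (.cons (numbering x.hd).tl (.cons .nil x.tl))

theorem polyTime_initialState : PolyTime initialState :=
  PolyTime.id.hd.cons ((polyTime_numbering PolyTime.id.hd).tl.cons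
    (PolyTime.nil.cons PolyTime.id.tl))

/-- The root of the search tree. -/
def State.root {n : ℕ} (G : SimpleGraph (Fin n)) (k : ℕ) : State where
  n := n
  G := G
  L := (List.finRange n).reverse
  k := k
  nodup := List.nodup_reverse.2 (List.nodup_finRange n)

theorem initialState_eq {n : ℕ} (G : SimpleGraph (Fin n)) (k : ℕ) :
    initialState (.cons (Data.ofGraph G) (Data.ofNat k)) = (State.root G k).enc := by
  have h1 : (Data.ofGraph G).toList.length = n := by simp [Data.ofGraph]
  have h2 : (List.range n).reverse.map Data.ofNat
      = (List.finRange n).reverse.map fun v : Fin n => Data.ofNat v := by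
    rw [← List.map_coe_finRange_eq_range, List.map_reverse, List.map_reverse, List.map_map]
    rfl
  have h3 : numbering (Data.ofGraph G)
      = .cons (Data.ofNat n) (Data.ofList ((List.finRange n).reverse.map fun v : Fin n =>
          Data.ofNat v)) := by
    rw [numbering, foldr_numbering, h1, h2]
  change Data.cons (Data.ofGraph G) (.cons (numbering (Data.ofGraph G)).tl
    (Data.ofNat (k + 1))) = _
  rw [h3]
  rfl

theorem size_input_le {n : ℕ} (G : SimpleGraph (Fin n)) (k : ℕ) :
    (Data.cons (Data.ofGraph G) (Data.ofNat k)).size ≤ 4 * ((n + 1) ^ 2 * (k + 1)) := by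
  have hbool : ∀ b, (Data.ofBool b).size ≤ 3 := by
    intro b
    cases b <;> simp [Data.ofBool, Data.size]
  have h : (Data.ofGraph G).size ≤ 1 + n * (n * 4 + 2) := by
    rw [Data.ofGraph, Data.size_ofList]
    refine Nat.add_le_add_left ((List.sum_le_card_nsmul _ (n * 4 + 2) fun m hm => ?_).trans
      (by simp)) 1
    simp only [List.mem_map, List.mem_ofFn] at hm
    obtain ⟨_, ⟨i, rfl⟩, rfl⟩ := hm
    rw [Data.size_ofList]
    have := List.sum_le_card_nsmul ((List.ofFn fun j => Data.ofBool
      (@decide (G.Adj i j) (Classical.propDecidable _))).map fun a => a.size + 1) 4 (by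
        intro m hm
        simp only [List.mem_map, List.mem_ofFn] at hm
        obtain ⟨_, ⟨j, rfl⟩, rfl⟩ := hm
        have := hbool (@decide (G.Adj i j) (Classical.propDecidable _))
        omega)
    simp only [List.length_map, List.length_ofFn, smul_eq_mul] at this
    omega
  rw [Data.size, size_ofNat]
  nlinarith [Nat.zero_le (n * k), Nat.zero_le (n ^ 2 * k)]

/-! ### The running time -/

theorem exists_eval_le (p : ℕ[X]) : ∃ C d : ℕ, ∀ m, 1 ≤ m → p.eval m ≤ C * m ^ d := by
  refine ⟨p.eval 1, p.natDegree, fun m hm => ?_⟩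
  rw [eval_eq_sum_range, eval_eq_sum_range, Finset.sum_mul]
  refine Finset.sum_le_sum fun i hi => ?_
  rw [one_pow, mul_one]
  exact Nat.mul_le_mul_left _
    (Nat.pow_le_pow_right hm (Nat.lt_succ_iff.1 (Finset.mem_range.1 hi)))

theorem exists_pow_mul_pow_le {a c : ℝ} (ha : 0 < a) (hac : a < c) (d : ℕ) :
    ∃ D : ℕ, ∀ k : ℕ, ((k : ℝ) + 1) ^ d * a ^ k ≤ D * c ^ k := by
  have hc : 0 < c := ha.trans hac
  have hr : |a / c| < 1 := by
    rw [abs_of_pos (by positivity), div_lt_one hc]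
    exact hac
  obtain ⟨B, hB⟩ := (tendsto_pow_const_mul_const_pow_of_abs_lt_one d hr).bddAbove_range
  obtain ⟨D, hD⟩ := exists_nat_ge (B * (c / a))
  refine ⟨D, fun k => ?_⟩
  have h := hB ⟨k + 1, rfl⟩
  simp only at h
  push_cast at h
  have h' : ((k : ℝ) + 1) ^ d * a ^ k = ((k : ℝ) + 1) ^ d * (a / c) ^ (k + 1) * (c / a) * c ^ k := by
    rw [div_pow, pow_succ a, pow_succ c]
    field_simp
  rw [h']
  refine mul_le_mul_of_nonneg_right (le_trans ?_ hD) (by positivity)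
  exact mul_le_mul_of_nonneg_right h (by positivity)

/-- The `l`-path vertex cover problem can be decided in time `O*(c ^ k)` for every `c` greater than
the square root of `l * (l + 1) / 2`. -/
theorem exists_decidesInTimeOStar {l : ℕ} (hl : 1 ≤ l) {c : ℝ} (hc : 0 < c)
    (hlc : (l * (l + 1) : ℝ) < 2 * c ^ 2) :
    ∃ P : Program, DecidesInTimeOStar P (fun _ G k => IsYesInstance l G k) c := by
  set a : ℝ := √(l * (l + 1) / 2) with ha
  have hl' : (1 : ℝ) ≤ l := by exact_mod_cast hl
  have ha2 : a ^ 2 = l * (l + 1) / 2 := Real.sq_sqrt (by positivity)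
  have ha1 : 1 ≤ a := by
    rw [ha, Real.one_le_sqrt]
    nlinarith
  have hac : a < c := by
    rw [ha, Real.sqrt_lt' hc]
    linarith
  obtain ⟨R, hR⟩ := exists_admissible (c := a) ha1 hl (by rw [ha2]; linarith)
  obtain ⟨P, p, hP⟩ := exists_search (polyTime_expand l a R) polyTime_initialState State.enc
    (fun s => HasCover l s.G s.L.toFinset s.k) (State.weight a) (fun s => s.L.length)
    (State.one_le_weight ha1) (fun s => by
      rcases State.expand_enc hR s with ⟨hnil, hE⟩ | ⟨f, L, hf, hL, hE⟩
      · exact Or.inl ⟨State.hasCover_of_eq_nil hl hnil, hE⟩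
      · refine Or.inr ⟨_, hE, State.hasCover_iff_exists_child hf hL, fun s' hs' => ?_,
          State.sum_weight_le ha1 hf hL⟩
        obtain ⟨b, hb, rfl⟩ := List.mem_map.1 hs'
        exact ⟨s.length_delete_lt hf (hL.nonempty b (List.mem_of_mem_filter hb)),
          s.size_enc_delete_le f b⟩)
  obtain ⟨C, d, hp⟩ := exists_eval_le p
  obtain ⟨D, hD⟩ := exists_pow_mul_pow_le (zero_lt_one.trans_le ha1) hac d
  refine ⟨P, C * 4 ^ d * D, 2 * d + 1, fun n G k => ?_⟩
  obtain ⟨t, ht, hle⟩ := hP _ (State.root G k) (initialState_eq G k)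
  refine ⟨t, ?_, ?_⟩
  · convert ht using 3
    refine (isYesInstance_iff_hasCover hl).trans ?_
    have : (State.root G k).L.toFinset = Finset.univ := by
      refine Finset.ext fun (v : Fin n) => ?_
      exact iff_of_true (List.mem_toFinset.2
        (List.mem_reverse.2 (List.mem_finRange v))) (Finset.mem_univ v)
    rw [this]
    rfl
  · have hsize : p.eval (Data.cons (Data.ofGraph G) (Data.ofNat k)).size
        ≤ C * (4 * ((n + 1) ^ 2 * (k + 1))) ^ d :=
      (hp _ (Data.one_le_size _)).trans
        (Nat.mul_le_mul_left _ (Nat.pow_le_pow_left (size_input_le G k) d))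
    have hsize' : ((p.eval (Data.cons (Data.ofGraph G) (Data.ofNat k)).size : ℕ) : ℝ)
        ≤ C * (4 * (((n : ℝ) + 1) ^ 2 * (k + 1))) ^ d := by exact_mod_cast hsize
    have hweight : (State.root G k).weight a = ((n : ℝ) + 1) * a ^ k := by
      simp [State.weight, State.root]
    rw [hweight] at hle
    calc (t : ℝ) ≤ ((n : ℝ) + 1) * a ^ k * (C * (4 * (((n : ℝ) + 1) ^ 2 * (k + 1))) ^ d) :=
          hle.trans (mul_le_mul_of_nonneg_left hsize' (by positivity))
      _ = C * 4 ^ d * ((n : ℝ) + 1) ^ (2 * d + 1) * (((k : ℝ) + 1) ^ d * a ^ k) := by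
          rw [mul_pow, mul_pow, ← pow_mul]
          ring
      _ ≤ C * 4 ^ d * ((n : ℝ) + 1) ^ (2 * d + 1) * (D * c ^ k) :=
          mul_le_mul_of_nonneg_left (hD k) (by positivity)
      _ = _ := by
          push_cast
          ring

end TreeLang

theorem mainTheorem1 :
    (∃ P : TreeLang.Program,
      TreeLang.DecidesInTimeOStar P (fun _ G k => PathCover.IsYesInstance 5 G k) 3.945) ∧
    (∃ P : TreeLang.Program,
      TreeLang.DecidesInTimeOStar P (fun _ G k => PathCover.IsYesInstance 6 G k) 4.947) ∧
    (∃ P : TreeLang.Program,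
      TreeLang.DecidesInTimeOStar P (fun _ G k => PathCover.IsYesInstance 7 G k) 5.951) := by
  refine ⟨TreeLang.exists_decidesInTimeOStar ?_ ?_ ?_, TreeLang.exists_decidesInTimeOStar ?_ ?_ ?_,
    TreeLang.exists_decidesInTimeOStar ?_ ?_ ?_⟩ <;> norm_num
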